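/- A subtree of a finite tree $T$ is a nonempty connected induced subgraph of $T$. The mean subtree order $\mu_T$ is the average number of vertices of the subtrees of $T$, and for a vertex $v$ the local mean subtree order $\mu_T(v)$ is the average number of vertices of the subtrees of $T$ that contain $v$. A vertex $v$ of $T$ is a centroid vertex if no connected component of $T - v$ contains more than half of the vertices of $T$. Let $f \colon \mathbb{R} \to \mathbb{R}$ be the $1$-periodic function with $f(x) = x - 2^x$ for $x \in [0,1]$. (a) There is a sequence $\varepsilon(n) \to 0$ such that for every tree $T$ with $n$ vertices and every centroid vertex $v$ of $T$, $$\mu_T(v) \le n - 2\log_2 n + 2 + f(2\log_2 n) + \varepsilon(n).$$ (b) There are sequences $\varepsilon_1(n) \to 0$ and $\varepsilon_2(n) \to 0$ such that for every $n \ge 1$ the maximum of $\mu_T$ over all trees $T$ with $n$ vertices satisfies $$n - 2\log_2 n + f(2\log_2 n) + \varepsilon_1(n) \;\le\; \max_{|T| = n} \mu_T \;\le\; n - 2\log_2 n + 2 + f(2\log_2 n) + \varepsilon_2(n).$$ -/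

import Mathlib

namespace SubtreeOrder

universe u

open Classical in
/-- The subtrees of `T` that contain all vertices of `A`. A subtree is a (nonempty) connected
induced subgraph; it is represented by its vertex set. -/
noncomputable def subtreesContaining {V : Type u} [Fintype V] (T : SimpleGraph V)
    (A : Finset V) : Finset (Finset V) :=
  Finset.univ.filter fun S => A ⊆ S ∧ (T.induce (S : Set V)).Connected

/-- The average number of vertices of the subtrees of `T` that contain all vertices of `A`. -/
noncomputable def meanOrderContaining {V : Type u} [Fintype V] (T : SimpleGraph V)
    (A : Finset V) : ℝ :=
  (∑ S ∈ subtreesContaining T A, (S.card : ℝ)) / ((subtreesContaining T A).card : ℝ)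

/-- The mean subtree order of `T`. -/
noncomputable def meanSubtreeOrder {V : Type u} [Fintype V] (T : SimpleGraph V) : ℝ :=
  meanOrderContaining T ∅

/-- The local mean subtree order of `T` at the vertex `v`. -/
noncomputable def localMeanSubtreeOrder {V : Type u} [Fintype V] (T : SimpleGraph V)
    (v : V) : ℝ :=
  meanOrderContaining T {v}

/-- `v` is a centroid vertex of `T`: no component of `T - v` contains more than half of the
vertices of `T`. -/
def IsCentroid {V : Type u} [Fintype V] (T : SimpleGraph V) (v : V) : Prop :=
  ∀ C : (T.induce ({v}ᶜ : Set V)).ConnectedComponent, 2 * C.supp.ncard ≤ Fintype.card V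

/-- The set of mean subtree orders of trees with `n` vertices. -/
def meanSubtreeOrders (n : ℕ) : Set ℝ :=
  {x | ∃ T : SimpleGraph (Fin n), T.IsTree ∧ meanSubtreeOrder T = x}

/-- The `1`-periodic function with `f x = x - 2 ^ x` on `[0, 1]`. -/
noncomputable def f (x : ℝ) : ℝ :=
  Int.fract x - (2 : ℝ) ^ Int.fract x

theorem f_periodic : Function.Periodic f 1 := by
  intro x
  simp [f]

theorem f_eq {x : ℝ} (hx : x ∈ Set.Icc (0 : ℝ) 1) : f x = x - (2 : ℝ) ^ x := by
  rcases hx.2.lt_or_eq with h | rfl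
  · simp [f, Int.fract_eq_self.2 ⟨hx.1, h⟩]
  · norm_num [f]

end SubtreeOrder

/-! Root the tree at `v` and order the vertices by ancestry. The subtrees containing `v` are `v`
together with the lower sets of the remaining vertices, so the local mean is `n` minus the deficit,
the average number of elements missed by a lower set. Lower-set counts multiply over branches, and
deficits add.

For a branch with `m` vertices and `N` lower sets, `MissingBound` says that the total number of
missed elements is at least `N * logInterp N + (m - 3 log₂ N)₊² / 2`. The first term is what `k`
leaves cost (`N = 2 ^ k`, deficit `k / 2`); the second is what a long stem costs (a chain of `m`
vertices misses about `m² / 2` in total). It is proved by induction over the two operations that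
build forests: adding a least element and taking disjoint unions. Optimising over `N` gives, up to
`o(1)`, a deficit of at least `min_k (k / 2 + m² / 2 ^ (k + 1))`, which is `minLine (m²)`; the
periodic function `f` appears because `k` must be an integer.

At a centroid every branch has at most `n / 2` vertices. Two branches of size about `n / 2` are
asymptotically cheapest: spreading the vertices more costs an extra multiple of `log n`, and a small
third branch costs at least `1 / 2`. The resulting deficit bound is `2 * minLine (n² / 4) = 2 log₂ n
- 2 - f (2 log₂ n)`, up to `o(1)`. Subtrees avoiding the centroid have at most `n / 2` vertices, so
the same bound holds for the global mean.

For the lower bound, take a path with `k = ⌊2 log₂ n⌋` leaves at each end. Its global deficit is at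
most `k + n² / 2 ^ k + o(1) = 2 * minLine (n²) + o(1)`. The gap of 2 between the bounds comes from
`minLine (n²) = minLine (n² / 4) + 1`. -/

namespace SubtreeOrder

open Finset

/-! ### Lower sets in finite subsets of a forest order -/

/-- A partial order, given as a relation, in which the elements below any element form a chain. -/
structure IsForestOrder {V : Type*} (r : V → V → Prop) : Prop where
  refl : ∀ x, r x x
  trans : ∀ x y z, r x y → r y z → r x z
  antisymm : ∀ x y, r x y → r y x → x = y
  chain : ∀ x y z, r x z → r y z → r x y ∨ r y x

section LowerSets

variable {V : Type*} (r : V → V → Prop)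

open Classical in
/-- The subsets of `A` that are closed downwards (within `A`) for the relation `r`. -/
noncomputable def lowerFamily (A : Finset V) : Finset (Finset V) :=
  A.powerset.filter fun S => ∀ x ∈ S, ∀ y ∈ A, r y x → y ∈ S

/-- The number of lower sets of `A`. -/
noncomputable def lowerCount (A : Finset V) : ℕ := (lowerFamily r A).card

/-- The total number of elements of `A` missed by the lower sets of `A`. -/
noncomputable def lowerMissing (A : Finset V) : ℝ :=
  ∑ S ∈ lowerFamily r A, ((A.card : ℝ) - S.card)

/-- The average number of elements of `A` missed by a lower set of `A`. -/
noncomputable def lowerDeficit (A : Finset V) : ℝ := lowerMissing r A / lowerCount r A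

variable {r}

theorem mem_lowerFamily {A S : Finset V} :
    S ∈ lowerFamily r A ↔ S ⊆ A ∧ ∀ x ∈ S, ∀ y ∈ A, r y x → y ∈ S := by
  simp [lowerFamily]

theorem empty_mem_lowerFamily (A : Finset V) : ∅ ∈ lowerFamily r A := by
  simp [mem_lowerFamily]

theorem self_mem_lowerFamily (A : Finset V) : A ∈ lowerFamily r A := by
  simp +contextual [mem_lowerFamily]

theorem lowerFamily_empty : lowerFamily r ∅ = {∅} := by
  ext S
  simp +contextual [mem_lowerFamily]

theorem lowerCount_pos (A : Finset V) : 0 < lowerCount r A :=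
  card_pos.2 ⟨∅, empty_mem_lowerFamily A⟩

theorem two_le_lowerCount {A : Finset V} (hA : A.Nonempty) : 2 ≤ lowerCount r A :=
  one_lt_card.2 ⟨∅, empty_mem_lowerFamily A, A, self_mem_lowerFamily A, hA.ne_empty.symm⟩

theorem lowerCount_le (A : Finset V) : lowerCount r A ≤ 2 ^ A.card := by
  rw [← card_powerset]
  exact card_le_card fun S hS => mem_powerset.2 (mem_lowerFamily.1 hS).1

theorem lowerCount_empty : lowerCount r (∅ : Finset V) = 1 := by
  simp [lowerCount, lowerFamily_empty]

theorem lowerMissing_empty : lowerMissing r (∅ : Finset V) = 0 := by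
  simp [lowerMissing, lowerFamily_empty]

section Plant

variable [DecidableEq V] {A : Finset V} {u : V}

/-- A nonempty lower set must contain the least element `u`, and containing `u` imposes no other
condition. So a least element adds exactly one lower set, the empty one, which misses all of `A`. -/
theorem lowerFamily_plant (hr : IsForestOrder r) (hu : u ∈ A) (hA : ∀ a ∈ A, r u a) :
    lowerFamily r A = insert ∅ ((lowerFamily r (A.erase u)).image (insert u)) := by
  ext S
  simp only [mem_insert, mem_image, mem_lowerFamily]
  constructor
  · rintro ⟨hSA, hS⟩
    rcases S.eq_empty_or_nonempty with h | ⟨x, hx⟩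
    · exact Or.inl h
    · have huS : u ∈ S := hS x hx u hu (hA x (hSA hx))
      refine Or.inr ⟨S.erase u, ⟨erase_subset_erase u hSA, ?_⟩, insert_erase huS⟩
      intro x hx y hy hxy
      exact mem_erase.2 ⟨(mem_erase.1 hy).1,
        hS x (mem_erase.1 hx).2 y (mem_erase.1 hy).2 hxy⟩
  · rintro (rfl | ⟨S', ⟨hSA, hS⟩, rfl⟩)
    · simp
    · refine ⟨insert_subset hu (hSA.trans (erase_subset _ _)), ?_⟩
      intro x hx y hy hxy
      by_cases hyu : y = u
      · simp [hyu]
      rcases mem_insert.1 hx with rfl | hx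
      · exact absurd (hr.antisymm _ _ hxy (hA y hy)) hyu
      · exact mem_insert_of_mem (hS x hx y (mem_erase.2 ⟨hyu, hy⟩) hxy)

theorem notMem_of_mem_lowerFamily_erase {S : Finset V} (hS : S ∈ lowerFamily r (A.erase u)) :
    u ∉ S := fun h => by simpa using (mem_lowerFamily.1 hS).1 h

theorem insert_injOn_lowerFamily_erase :
    Set.InjOn (insert u) (lowerFamily r (A.erase u) : Set (Finset V)) := by
  intro S hS S' hS' h
  have := congrArg (fun X => Finset.erase X u) h
  simpa [erase_insert (notMem_of_mem_lowerFamily_erase hS),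
    erase_insert (notMem_of_mem_lowerFamily_erase hS')] using this

theorem empty_notMem_image_insert (F : Finset (Finset V)) : ∅ ∉ F.image (insert u) := by
  simp

theorem lowerCount_plant (hr : IsForestOrder r) (hu : u ∈ A) (hA : ∀ a ∈ A, r u a) :
    lowerCount r A = lowerCount r (A.erase u) + 1 := by
  rw [lowerCount, lowerFamily_plant hr hu hA, card_insert_of_notMem (empty_notMem_image_insert _),
    card_image_of_injOn insert_injOn_lowerFamily_erase, lowerCount]

theorem lowerMissing_plant (hr : IsForestOrder r) (hu : u ∈ A) (hA : ∀ a ∈ A, r u a) :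
    lowerMissing r A = lowerMissing r (A.erase u) + A.card := by
  rw [lowerMissing, lowerFamily_plant hr hu hA, sum_insert (empty_notMem_image_insert _),
    sum_image insert_injOn_lowerFamily_erase, lowerMissing, add_comm, card_empty, Nat.cast_zero,
    sub_zero]
  congr 1
  refine sum_congr rfl fun S hS => ?_
  rw [card_insert_of_notMem (notMem_of_mem_lowerFamily_erase hS),
    ← card_erase_add_one hu]
  push_cast
  ring

end Plant

section Merge

variable [DecidableEq V] {A B : Finset V}

theorem lowerFamily_union (hAB : ∀ a ∈ A, ∀ b ∈ B, ¬ r a b ∧ ¬ r b a) :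
    lowerFamily r (A ∪ B) =
      (lowerFamily r A ×ˢ lowerFamily r B).image fun p => p.1 ∪ p.2 := by
  ext S
  simp only [mem_image, mem_product, mem_lowerFamily, Prod.exists]
  constructor
  · rintro ⟨hS, h⟩
    refine ⟨S ∩ A, S ∩ B, ⟨⟨inter_subset_right, ?_⟩, inter_subset_right, ?_⟩, ?_⟩
    · intro x hx y hy hxy
      exact mem_inter.2 ⟨h x (mem_inter.1 hx).1 y (mem_union_left _ hy) hxy, hy⟩
    · intro x hx y hy hxy
      exact mem_inter.2 ⟨h x (mem_inter.1 hx).1 y (mem_union_right _ hy) hxy, hy⟩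
    · rw [← inter_union_distrib_left]
      exact inter_eq_left.2 hS
  · rintro ⟨S, S', ⟨⟨hSA, hS⟩, hSB, hS'⟩, rfl⟩
    refine ⟨union_subset_union hSA hSB, ?_⟩
    intro x hx y hy hxy
    rcases mem_union.1 hx with hx | hx <;> rcases mem_union.1 hy with hy | hy
    · exact mem_union_left _ (hS x hx y hy hxy)
    · exact absurd hxy (hAB x (hSA hx) y hy).2
    · exact absurd hxy (hAB y hy x (hSB hx)).1
    · exact mem_union_right _ (hS' x hx y hy hxy)

theorem union_injOn_lowerFamily (hd : Disjoint A B) :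
    Set.InjOn (fun p : Finset V × Finset V => p.1 ∪ p.2)
      (lowerFamily r A ×ˢ lowerFamily r B : Finset (Finset V × Finset V)) := by
  rintro ⟨S, S'⟩ hS ⟨R, R'⟩ hR h
  simp only [coe_product, Set.mem_prod, mem_coe, mem_lowerFamily] at hS hR
  have hd' := Finset.disjoint_left.1 hd
  simp only [Prod.mk.injEq, Finset.ext_iff, mem_union] at h ⊢
  constructor
  · intro x
    have h1 := @hS.1.1 x
    have h2 := @hS.2.1 x
    have h3 := @hR.1.1 x
    have h4 := @hR.2.1 x
    have h5 := @hd' x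
    have h6 := h x
    tauto
  · intro x
    have h1 := @hS.1.1 x
    have h2 := @hS.2.1 x
    have h3 := @hR.1.1 x
    have h4 := @hR.2.1 x
    have h5 := @hd' x
    have h6 := h x
    tauto

theorem lowerCount_union (hd : Disjoint A B) (hAB : ∀ a ∈ A, ∀ b ∈ B, ¬ r a b ∧ ¬ r b a) :
    lowerCount r (A ∪ B) = lowerCount r A * lowerCount r B := by
  rw [lowerCount, lowerFamily_union hAB, card_image_of_injOn (union_injOn_lowerFamily hd),
    card_product, lowerCount, lowerCount]

theorem lowerMissing_union (hd : Disjoint A B) (hAB : ∀ a ∈ A, ∀ b ∈ B, ¬ r a b ∧ ¬ r b a) :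
    lowerMissing r (A ∪ B) =
      lowerMissing r A * lowerCount r B + lowerCount r A * lowerMissing r B := by
  rw [lowerMissing, lowerFamily_union hAB, sum_image (union_injOn_lowerFamily hd)]
  have : ∀ p ∈ lowerFamily r A ×ˢ lowerFamily r B,
      (((A ∪ B).card : ℝ) - (p.1 ∪ p.2).card) =
        ((A.card : ℝ) - p.1.card) + ((B.card : ℝ) - p.2.card) := by
    rintro ⟨S, S'⟩ hp
    simp only [mem_product, mem_lowerFamily] at hp
    rw [card_union_of_disjoint hd,
      card_union_of_disjoint (disjoint_of_subset_left hp.1.1 (disjoint_of_subset_right hp.2.1 hd))]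
    push_cast
    ring
  rw [sum_congr rfl this, sum_add_distrib, sum_product, sum_product_right]
  simp only [sum_const, nsmul_eq_mul, lowerMissing, lowerCount, sum_mul, mul_sum]
  congr 1
  exact sum_congr rfl fun _ _ => mul_comm _ _

/-- Lower sets of unrelated parts are chosen independently: counts multiply and missing totals obey
a product rule, so their quotient is additive. -/
theorem lowerDeficit_union (hd : Disjoint A B) (hAB : ∀ a ∈ A, ∀ b ∈ B, ¬ r a b ∧ ¬ r b a) :
    lowerDeficit r (A ∪ B) = lowerDeficit r A + lowerDeficit r B := by
  have hA : (lowerCount r A : ℝ) ≠ 0 := by exact_mod_cast (lowerCount_pos A).ne'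
  have hB : (lowerCount r B : ℝ) ≠ 0 := by exact_mod_cast (lowerCount_pos B).ne'
  rw [lowerDeficit, lowerDeficit, lowerDeficit, lowerMissing_union hd hAB, lowerCount_union hd hAB]
  push_cast
  field_simp

end Merge

theorem IsForestOrder.exists_minimal (hr : IsForestOrder r) {A : Finset V} (hA : A.Nonempty) :
    ∃ u ∈ A, ∀ y ∈ A, r y u → y = u := by
  classical
  obtain ⟨u, hu, h⟩ := exists_min_image A (fun x => (A.filter fun y => r y x).card) hA
  refine ⟨u, hu, fun y hy hyu => ?_⟩
  by_contra hne
  refine (h y hy).not_gt (card_lt_card ((ssubset_iff_of_subset ?_).2 ⟨u, ?_, ?_⟩))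
  · intro z hz
    rw [mem_filter] at hz ⊢
    exact ⟨hz.1, hr.trans _ _ _ hz.2 hyu⟩
  · simp [hu, hr.refl]
  · simp only [mem_filter, not_and]
    exact fun _ h' => hne (hr.antisymm _ _ hyu h')

/-- Finite subsets of a forest order are built from the empty set by adding a least element and
by forming unions of unrelated sets. -/
theorem IsForestOrder.induction [DecidableEq V] (hr : IsForestOrder r) {P : Finset V → Prop}
    (empty : P ∅)
    (plant : ∀ A u, u ∈ A → (∀ a ∈ A, r u a) → P (A.erase u) → P A)
    (merge : ∀ A B, A.Nonempty → Disjoint A B → (∀ a ∈ A, ∀ b ∈ B, ¬ r a b ∧ ¬ r b a) →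
      P A → P B → P (A ∪ B)) (A : Finset V) : P A := by
  classical
  induction A using Finset.strongInduction with
  | H A ih =>
    rcases A.eq_empty_or_nonempty with rfl | hA
    · exact empty
    obtain ⟨u, hu, hmin⟩ := hr.exists_minimal hA
    have hu' : u ∈ A.filter (r u) := mem_filter.2 ⟨hu, hr.refl u⟩
    rw [← filter_union_filter_not_eq (r u) A]
    refine merge _ _ ⟨u, hu'⟩ (disjoint_filter_filter_not _ _ _) ?_ ?_ ?_
    · intro a ha b hb
      rw [mem_filter] at ha hb
      refine ⟨fun h => hb.2 (hr.trans _ _ _ ha.2 h), fun h => ?_⟩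
      -- Both `u` and `b` lie below `a`, hence are comparable; `u` below `b` contradicts the choice
      -- of `b`, and `b` below `u` forces `b = u` by minimality.
      rcases hr.chain _ _ _ ha.2 h with h' | h'
      · exact hb.2 h'
      · exact hb.2 (hmin b hb.1 h' ▸ hr.refl b)
    · refine plant _ u hu' (fun a ha => (mem_filter.1 ha).2) (ih _ ?_)
      exact (erase_ssubset hu').trans_subset (filter_subset _ _)
    · refine ih _ ((ssubset_iff_of_subset (filter_subset _ _)).2 ⟨u, hu, ?_⟩)
      simp [hr.refl]

end LowerSets

/-! ### The lower bound for the average number of missing elements -/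

/-- This is the optimality of the exponent `k` for `y = 2 ^ k * s`: it rearranges to `k + s ≤ (k -
i) + s * 2 ^ i`. The cases `i = 1` and `i = -1` force exactly the range `1 ≤ s ≤ 2`. -/
theorem intCast_le_mul_two_zpow_sub_one (i : ℤ) {s : ℝ} (h1 : 1 ≤ s) (h2 : s ≤ 2) :
    (i : ℝ) ≤ s * ((2 : ℝ) ^ i - 1) := by
  rcases le_or_gt 0 i with hi | hi
  · lift i to ℕ using hi
    have := one_add_mul_le_pow (a := (1 : ℝ)) (by norm_num) i
    norm_num at this ⊢
    have h : (0 : ℝ) ≤ i := Nat.cast_nonneg _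
    nlinarith
  · have hpos : (0 : ℝ) < (2 : ℝ) ^ i := by positivity
    rcases eq_or_lt_of_le (Int.le_sub_one_of_lt hi) with h | h
    · subst h
      norm_num
      linarith
    · have : (i : ℝ) ≤ -2 := by exact_mod_cast (by omega : i ≤ -2)
      nlinarith

/-- The piecewise linear (in `1 / N`) interpolation of the values `k / 2` at `N = 2 ^ k`. -/
noncomputable def logInterp (N : ℕ) : ℝ :=
  (Nat.log 2 N : ℝ) / 2 + 1 - 2 ^ Nat.log 2 N / N

theorem exists_scaling_two {N : ℕ} (hN : 0 < N) :
    ∃ s : ℝ, 1 ≤ s ∧ s ≤ 2 ∧ (N : ℝ) = 2 ^ Nat.log 2 N * s := by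
  have h1 : ((2 ^ Nat.log 2 N : ℕ) : ℝ) ≤ N := by exact_mod_cast Nat.pow_log_le_self 2 hN.ne'
  have h2 : (N : ℝ) ≤ ((2 ^ (Nat.log 2 N + 1) : ℕ) : ℝ) := by
    exact_mod_cast (Nat.lt_pow_succ_log_self (by norm_num) N).le
  push_cast [pow_succ] at h1 h2
  have hp : (0 : ℝ) < 2 ^ Nat.log 2 N := by positivity
  refine ⟨N / 2 ^ Nat.log 2 N, ?_, ?_, ?_⟩
  · rwa [le_div_iff₀ hp, one_mul]
  · rw [div_le_iff₀ hp]; linarith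
  · field_simp

/-- `logInterp` is the upper envelope of these lines in `1 / N`, so a lower bound for it may use any
exponent `j`, in particular the one belonging to `N + 1`. -/
theorem line_le_logInterp {N : ℕ} (hN : 0 < N) (j : ℕ) :
    (j : ℝ) / 2 + 1 - 2 ^ j / N ≤ logInterp N := by
  obtain ⟨s, h1, h2, hs⟩ := exists_scaling_two hN
  have hs0 : 0 < s := by linarith
  have h := intCast_le_mul_two_zpow_sub_one ((j : ℤ) - Nat.log 2 N) (s := 2 / s)
    (by rw [le_div_iff₀ hs0]; linarith) (by rw [div_le_iff₀ hs0]; linarith)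
  rw [zpow_sub₀ (by norm_num), zpow_natCast, zpow_natCast] at h
  have hp : (0 : ℝ) < 2 ^ Nat.log 2 N := by positivity
  rw [logInterp, hs]
  push_cast at h
  have e1 : (2 : ℝ) ^ Nat.log 2 N / (2 ^ Nat.log 2 N * s) = 1 / s := by field_simp
  have e2 : 2 / s * ((2 : ℝ) ^ j / 2 ^ Nat.log 2 N - 1) =
    2 * (2 ^ j / (2 ^ Nat.log 2 N * s)) - 2 * (1 / s) := by field_simp
  rw [e2] at h
  rw [e1]
  linarith

/-- With `a = 1 / s` and `b = 1 / t` in `[1/2, 1]`, the claim is `(1 - a)(1 - b) ≥ 0` when the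
integer logarithms add exactly, and `2(a - 1/2)(b - 1/2) ≥ 0` when there is a carry. -/
theorem logInterp_mul_le {M N : ℕ} (hM : 0 < M) (hN : 0 < N) :
    logInterp (M * N) ≤ logInterp M + logInterp N := by
  obtain ⟨s, h1, h2, hs⟩ := exists_scaling_two hM
  obtain ⟨t, h3, h4, ht⟩ := exists_scaling_two hN
  have hs0 : 0 < s := by linarith
  have ht0 : 0 < t := by linarith
  set k := Nat.log 2 M with hk
  set l := Nat.log 2 N with hl
  have hlog : Nat.log 2 (M * N) = k + l ∨ Nat.log 2 (M * N) = k + l + 1 := by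
    have a1 := Nat.pow_log_le_self 2 hM.ne'
    have a2 := Nat.pow_log_le_self 2 hN.ne'
    have a3 := Nat.lt_pow_succ_log_self (b := 2) (by norm_num) M
    have a4 := Nat.lt_pow_succ_log_self (b := 2) (by norm_num) N
    have lo : k + l ≤ Nat.log 2 (M * N) := by
      refine Nat.le_log_of_pow_le (by norm_num) ?_
      rw [pow_add]
      exact Nat.mul_le_mul a1 a2
    have hi : Nat.log 2 (M * N) < k + l + 2 := by
      refine Nat.log_lt_of_lt_pow (by positivity) ?_
      calc M * N < 2 ^ (k + 1) * 2 ^ (l + 1) := Nat.mul_lt_mul'' a3 a4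
        _ = 2 ^ (k + l + 2) := by ring
    omega
  have es : (2 : ℝ) ^ k / M = 1 / s := by rw [hs]; field_simp
  have et : (2 : ℝ) ^ l / N = 1 / t := by rw [ht]; field_simp
  have est : (2 : ℝ) ^ (k + l) / ((M * N : ℕ) : ℝ) = 1 / s * (1 / t) := by
    push_cast
    rw [hs, ht, pow_add]; field_simp
  have b1 : 1 / s ≤ 1 := by rw [div_le_iff₀ hs0]; linarith
  have b2 : 1 / t ≤ 1 := by rw [div_le_iff₀ ht0]; linarith
  have b3 : 1 / 2 ≤ 1 / s := one_div_le_one_div_of_le hs0 h2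
  have b4 : 1 / 2 ≤ 1 / t := one_div_le_one_div_of_le ht0 h4
  rw [logInterp, logInterp, logInterp, ← hk, ← hl, es, et]
  rcases hlog with h | h
  · rw [h, est]
    push_cast
    nlinarith
  · rw [h, pow_succ, mul_div_right_comm, est]
    push_cast
    nlinarith

/-- The bound satisfied by the number `N` of lower sets and the total number `W` of missing
elements of a set with `e` elements. -/
def MissingBound (e N : ℕ) (W : ℝ) : Prop :=
  N * logInterp N + (max 0 ((e : ℝ) - 3 * Real.logb 2 N)) ^ 2 / 2 ≤ W

/-- The logarithmic parts combine by `logInterp_mul_le`. For the quadratic parts, `(a + b)² ≤ 2a² +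
2b²`, and each factor 2 is absorbed by the count of the other part. -/
theorem MissingBound.merge {e₁ e₂ N₁ N₂ : ℕ} {W₁ W₂ : ℝ} (h₁ : MissingBound e₁ N₁ W₁)
    (h₂ : MissingBound e₂ N₂ W₂) (hN₁ : 2 ≤ N₁) (hN₂ : 2 ≤ N₂) :
    MissingBound (e₁ + e₂) (N₁ * N₂) (W₁ * N₂ + N₁ * W₂) := by
  unfold MissingBound at *
  have c₁ : (2 : ℝ) ≤ N₁ := by exact_mod_cast hN₁
  have c₂ : (2 : ℝ) ≤ N₂ := by exact_mod_cast hN₂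
  set a := max 0 ((e₁ : ℝ) - 3 * Real.logb 2 N₁) with ha
  set b := max 0 ((e₂ : ℝ) - 3 * Real.logb 2 N₂) with hb
  have hab : max 0 (((e₁ + e₂ : ℕ) : ℝ) - 3 * Real.logb 2 ((N₁ * N₂ : ℕ) : ℝ)) ≤ a + b := by
    push_cast
    rw [Real.logb_mul (by positivity) (by positivity)]
    refine max_le (add_nonneg (le_max_left _ _) (le_max_left _ _)) ?_
    have := le_max_right 0 ((e₁ : ℝ) - 3 * Real.logb 2 N₁)
    have := le_max_right 0 ((e₂ : ℝ) - 3 * Real.logb 2 N₂)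
    linarith
  have hsq := pow_le_pow_left₀ (le_max_left _ _) hab 2
  have hΦ := logInterp_mul_le (by omega : 0 < N₁) (by omega : 0 < N₂)
  have m1 := mul_le_mul_of_nonneg_right h₁ (by linarith : (0 : ℝ) ≤ N₂)
  have m2 := mul_le_mul_of_nonneg_left h₂ (by linarith : (0 : ℝ) ≤ N₁)
  have m3 := mul_le_mul_of_nonneg_left hΦ (by positivity : (0 : ℝ) ≤ N₁ * N₂)
  have m4 := mul_le_mul_of_nonneg_right c₂ (sq_nonneg a)
  have m5 := mul_le_mul_of_nonneg_right c₁ (sq_nonneg b)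
  push_cast at hsq m3 ⊢
  nlinarith [sq_nonneg (a - b)]

/-- With `k` the integer logarithm of `N + 1`, the first term grows by at most `k / 2 + 1`, and the
square term by at most `r + 1 / 2` with `r = e - 3 log₂ N` when `r ≥ 0`. The subtracted `3 log₂ N`
pays for `k`, since `k ≤ 2 log₂ N`, so the gain `e + 1` suffices. This needs `log₂ N ≥ 1`; hence `N
= 1` is separate. -/
theorem MissingBound.plant {e N : ℕ} {W : ℝ} (h : MissingBound e N W) (hN : 1 ≤ N)
    (hNe : N ≤ 2 ^ e) : MissingBound (e + 1) (N + 1) (W + (e + 1)) := by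
  unfold MissingBound at *
  rcases eq_or_lt_of_le hN with rfl | hN2
  · have l2 : Nat.log 2 (1 + 1) = 1 := by norm_num
    simp only [logInterp, l2] at h ⊢
    norm_num at h ⊢
    have h0 : (0 : ℝ) ≤ e := Nat.cast_nonneg _
    have : max 0 ((e : ℝ) + 1 - 3) ≤ e := max_le h0 (by linarith)
    have := pow_le_pow_left₀ (le_max_left _ _) this 2
    linarith
  have he : 1 ≤ e := by
    rcases Nat.eq_zero_or_pos e with rfl | h'
    · simp at hNe; omega
    · exact h'
  have heR : (1 : ℝ) ≤ e := by exact_mod_cast he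
  set k := Nat.log 2 (N + 1) with hk
  have hkN : 2 ^ k ≤ N + 1 := Nat.pow_log_le_self 2 (by omega)
  have hke : k ≤ e := by
    by_contra hlt
    have h3 : 2 ^ (e + 1) ≤ 2 ^ k := Nat.pow_le_pow_right (by norm_num) (by omega)
    have h4 : 2 ^ 1 ≤ 2 ^ e := Nat.pow_le_pow_right (by norm_num) he
    rw [pow_succ] at h3
    omega
  have hkeR : (k : ℝ) ≤ e := by exact_mod_cast hke
  have hNpos : (0 : ℝ) < N := by exact_mod_cast (by omega : 0 < N)
  have hlogN : 1 ≤ Real.logb 2 N := by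
    rw [Real.le_logb_iff_rpow_le (by norm_num) hNpos, Real.rpow_one]
    exact_mod_cast hN2
  have hklog : (k : ℝ) ≤ 2 * Real.logb 2 N := by
    have h5 : (2 : ℝ) ^ (k : ℝ) ≤ N * N := by
      rw [Real.rpow_natCast]
      exact_mod_cast hkN.trans (by nlinarith)
    rw [← Real.le_logb_iff_rpow_le (by norm_num) (by positivity),
      Real.logb_mul hNpos.ne' hNpos.ne'] at h5
    linarith
  have hline := mul_le_mul_of_nonneg_left (line_le_logInterp (by omega : 0 < N) k) hNpos.le
  have e1 : (N : ℝ) * ((k : ℝ) / 2 + 1 - 2 ^ k / N) = N * ((k : ℝ) / 2 + 1) - 2 ^ k := by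
    field_simp
  have e2 : ((N + 1 : ℕ) : ℝ) * logInterp (N + 1) = (N + 1) * ((k : ℝ) / 2 + 1) - 2 ^ k := by
    rw [logInterp, ← hk]
    push_cast
    field_simp
  rw [e1] at hline
  rw [e2]
  have hmono : Real.logb 2 N ≤ Real.logb 2 ((N + 1 : ℕ) : ℝ) :=
    Real.logb_le_logb_of_le (by norm_num) hNpos (by push_cast; linarith)
  set r := (e : ℝ) - 3 * Real.logb 2 N with hr
  set r' := ((e + 1 : ℕ) : ℝ) - 3 * Real.logb 2 ((N + 1 : ℕ) : ℝ) with hr'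
  have hrr : r' ≤ r + 1 := by rw [hr, hr', Nat.cast_add e 1, Nat.cast_one]; linarith
  rcases le_total r' 0 with c1 | c1
  · rw [max_eq_left c1]
    have := sq_nonneg (max 0 r)
    nlinarith
  rw [max_eq_right c1]
  -- If `r ≤ 0` then `r' ≤ 1`, and `k ≤ e` pays for the growth; otherwise `r'² ≤ (r + 1)²`.
  rcases le_total r 0 with c2 | c2
  · rw [max_eq_left c2] at h
    nlinarith
  · rw [max_eq_right c2] at h
    nlinarith

theorem missingBound_lower {V : Type*} {r : V → V → Prop} (hr : IsForestOrder r)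
    (A : Finset V) : MissingBound A.card (lowerCount r A) (lowerMissing r A) := by
  classical
  induction A using hr.induction with
  | empty => simp [MissingBound, lowerCount_empty, lowerMissing_empty, logInterp]
  | plant A u hu hA ih =>
    rw [lowerCount_plant hr hu hA, lowerMissing_plant hr hu hA, ← card_erase_add_one hu]
    push_cast
    exact ih.plant (lowerCount_pos _) (lowerCount_le _)
  | merge A B hA hd hAB ihA ihB =>
    rcases B.eq_empty_or_nonempty with rfl | hB
    · simpa using ihA
    rw [card_union_of_disjoint hd, lowerCount_union hd hAB, lowerMissing_union hd hAB]
    exact ihA.merge ihB (two_le_lowerCount hA) (two_le_lowerCount hB)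

theorem logInterp_add_le_lowerDeficit {V : Type*} {r : V → V → Prop} (hr : IsForestOrder r)
    (A : Finset V) :
    logInterp (lowerCount r A) +
      (max 0 ((A.card : ℝ) - 3 * Real.logb 2 (lowerCount r A))) ^ 2 / (2 * lowerCount r A) ≤
      lowerDeficit r A := by
  have hN : (0 : ℝ) < lowerCount r A := by exact_mod_cast lowerCount_pos A
  have h := missingBound_lower hr A
  rw [MissingBound] at h
  rw [lowerDeficit, le_div_iff₀ hN]
  refine le_trans (le_of_eq ?_) h
  field_simp

/-- A finite set splits into sets with a least element that do not interact. -/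
theorem IsForestOrder.exists_branches {V : Type*} {r : V → V → Prop} (hr : IsForestOrder r)
    (A : Finset V) : ∃ s : Multiset (Finset V), (∀ B ∈ s, ∃ u ∈ B, ∀ b ∈ B, r u b) ∧
      (∀ B ∈ s, B ⊆ A) ∧ (s.map Finset.card).sum = A.card ∧
      (s.map (lowerDeficit r)).sum = lowerDeficit r A := by
  classical
  induction A using hr.induction with
  | empty => exact ⟨0, by simp, by simp, by simp, by simp [lowerDeficit, lowerMissing_empty]⟩
  | plant A u hu hA ih => exact ⟨{A}, by simpa using ⟨u, hu, hA⟩, by simp, by simp, by simp⟩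
  | merge A B hA hd hAB ihA ihB =>
    obtain ⟨s, h1, h2, h3, h4⟩ := ihA
    obtain ⟨t, k1, k2, k3, k4⟩ := ihB
    refine ⟨s + t, ?_, ?_, ?_, ?_⟩
    · intro C hC
      exact (Multiset.mem_add.1 hC).elim (h1 C) (k1 C)
    · intro C hC
      exact (Multiset.mem_add.1 hC).elim (fun h => (h2 C h).trans subset_union_left)
        (fun h => (k2 C h).trans subset_union_right)
    · simp [h3, k3, card_union_of_disjoint hd]
    · simp [h4, k4, lowerDeficit_union hd hAB]

end SubtreeOrder

namespace SubtreeOrder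

open Finset Filter Topology

/-! ### The limiting lower bound -/

/-- The function `y ↦ min_k (k / 2 + y / 2 ^ (k + 1))`, for `y > 0`. -/
noncomputable def minLine (y : ℝ) : ℝ := (Real.logb 2 y - f (Real.logb 2 y)) / 2

/-- The line with index `k = ⌊log₂ y⌋` attains the minimum: here `s = y / 2 ^ k` is 2 to the
fractional part of `log₂ y`, the exponential term in `f`. -/
theorem exists_minLine_eq {y : ℝ} (hy : 0 < y) : ∃ s : ℝ, 1 ≤ s ∧ s ≤ 2 ∧
    y = (2 : ℝ) ^ ⌊Real.logb 2 y⌋ * s ∧ minLine y = (⌊Real.logb 2 y⌋ + s) / 2 := by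
  refine ⟨(2 : ℝ) ^ Int.fract (Real.logb 2 y), ?_, ?_, ?_, ?_⟩
  · exact Real.one_le_rpow (by norm_num) (Int.fract_nonneg _)
  · calc (2 : ℝ) ^ Int.fract (Real.logb 2 y) ≤ 2 ^ (1 : ℝ) :=
        Real.rpow_le_rpow_of_exponent_le (by norm_num) (Int.fract_lt_one _).le
      _ = 2 := Real.rpow_one 2
  · rw [← Real.rpow_intCast, ← Real.rpow_add (by norm_num), Int.floor_add_fract,
      Real.rpow_logb (by norm_num) (by norm_num) hy]
  · rw [minLine, f]
    congr 1
    have := Int.floor_add_fract (Real.logb 2 y)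
    linarith

theorem minLine_le {y : ℝ} (hy : 0 < y) (k : ℤ) :
    minLine y ≤ (k : ℝ) / 2 + y / (2 * (2 : ℝ) ^ k) := by
  obtain ⟨s, h1, h2, hs, hm⟩ := exists_minLine_eq hy
  have h := intCast_le_mul_two_zpow_sub_one (⌊Real.logb 2 y⌋ - k) h1 h2
  rw [zpow_sub₀ (by norm_num)] at h
  have hk : (0 : ℝ) < (2 : ℝ) ^ k := by positivity
  have e : y / (2 * (2 : ℝ) ^ k) = s * ((2 : ℝ) ^ ⌊Real.logb 2 y⌋ / 2 ^ k) / 2 := by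
    nth_rewrite 1 [hs]
    field_simp
  rw [hm, e]
  push_cast at h
  linarith

/-- The line that is optimal at `z` has slope `1 / (2 * 2 ^ k)`, at most `1 / z` because `z ≤ 2 * 2
^ k`, and it still lies above `minLine` at `y`. -/
theorem minLine_le_add {y z : ℝ} (hy : 0 < y) (hz : 0 < z) (hzy : z ≤ y) :
    minLine y ≤ minLine z + (y - z) / z := by
  obtain ⟨s, h1, h2, hs, hm⟩ := exists_minLine_eq hz
  have h := minLine_le hy ⌊Real.logb 2 z⌋
  set q := (2 : ℝ) ^ ⌊Real.logb 2 z⌋ with hq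
  have hq0 : 0 < q := by positivity
  have e1 : y / (2 * q) = s / 2 + (y - z) / (2 * q) := by
    rw [sub_div, hs]
    field_simp
    ring
  have e2 : (y - z) / (2 * q) ≤ (y - z) / z := by
    refine div_le_div_of_nonneg_left (by linarith) hz ?_
    rw [hs, mul_comm]
    exact mul_le_mul_of_nonneg_right h2 hq0.le
  rw [e1] at h
  rw [hm]
  linarith

theorem minLine_mono {y z : ℝ} (hy : 0 < y) (hyz : y ≤ z) : minLine y ≤ minLine z := by
  have hz : 0 < z := by linarith
  obtain ⟨s, h1, h2, hs, hm⟩ := exists_minLine_eq hz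
  have h := minLine_le hy ⌊Real.logb 2 z⌋
  set q := (2 : ℝ) ^ ⌊Real.logb 2 z⌋ with hq
  have hq0 : 0 < q := by positivity
  have e1 : y / (2 * q) ≤ s / 2 := by
    rw [div_le_iff₀ (by positivity)]
    linarith
  rw [hm]
  linarith

theorem f_nonpos (x : ℝ) : f x ≤ 0 := by
  have h := one_add_mul_self_le_rpow_one_add (s := 1) (by norm_num) (p := 1 + Int.fract x)
    (by linarith [Int.fract_nonneg x])
  have h2 : (2 : ℝ) ^ (1 + Int.fract x) = 2 * 2 ^ Int.fract x := by
    rw [Real.rpow_add (by norm_num), Real.rpow_one]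
  norm_num at h
  rw [h2] at h
  rw [f]
  linarith [Int.fract_lt_one x]

theorem logb_le_minLine (y : ℝ) : Real.logb 2 y / 2 ≤ minLine y := by
  rw [minLine]
  linarith [f_nonpos (Real.logb 2 y)]

theorem minLine_le_logb {y : ℝ} (hy : 0 < y) : minLine y ≤ Real.logb 2 y / 2 + 1 := by
  obtain ⟨s, h1, h2, hs, hm⟩ := exists_minLine_eq hy
  rw [hm]
  linarith [Int.floor_le (Real.logb 2 y)]

/-- For `N = 2 ^ k * s` the right side is exactly the convex combination of the lines with indices
`k` and `k + 1`, with weights `2 / s - 1` and `2 - 2 / s`. -/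
theorem minLine_le_logInterp_add {N : ℕ} (hN : 0 < N) {y : ℝ} (hy : 0 < y) :
    minLine y ≤ logInterp N + y / (2 * N) := by
  obtain ⟨s, h1, h2, hs⟩ := exists_scaling_two hN
  have hs0 : 0 < s := by linarith
  have a := minLine_le hy (Nat.log 2 N : ℤ)
  have b := minLine_le hy ((Nat.log 2 N : ℤ) + 1)
  rw [zpow_add_one₀ (by norm_num)] at b
  simp only [zpow_natCast] at a b
  push_cast at a b
  rw [logInterp, hs]
  set q := (2 : ℝ) ^ Nat.log 2 N with hq
  have hq0 : 0 < q := by positivity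
  have e1 : q / (q * s) = 1 / s := by field_simp
  have e2 : y / (2 * (q * s)) = y / (2 * q) * (1 / s) := by field_simp
  have e3 : y / (2 * (q * 2)) = y / (2 * q) / 2 := by field_simp
  have b1 : 1 / s ≤ 1 := by rw [div_le_iff₀ hs0]; linarith
  have b3 : 1 / 2 ≤ 1 / s := one_div_le_one_div_of_le hs0 h2
  rw [e3] at b
  rw [e1, e2]
  nlinarith

theorem half_le_logInterp {N : ℕ} (hN : 2 ≤ N) : 1 / 2 ≤ logInterp N := by
  have h := line_le_logInterp (by omega : 0 < N) 1
  have hN' : (2 : ℝ) ≤ N := by exact_mod_cast hN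
  have : (2 : ℝ) ^ 1 / N ≤ 1 := by rw [div_le_one (by linarith)]; linarith
  push_cast at h
  linarith

theorem logb_sub_le_logInterp {N : ℕ} (hN : 0 < N) :
    (Real.logb 2 N - 1) / 2 ≤ logInterp N := by
  obtain ⟨s, h1, h2, hs⟩ := exists_scaling_two hN
  have hs0 : 0 < s := by linarith
  rw [logInterp]
  have e : (2 : ℝ) ^ Nat.log 2 N / N ≤ 1 := by
    rw [div_le_one (by exact_mod_cast hN)]
    rw [hs]
    nlinarith [pow_pos (two_pos : (0 : ℝ) < 2) (Nat.log 2 N)]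
  have : Real.logb 2 N ≤ Nat.log 2 N + 1 := by
    rw [Real.logb_le_iff_le_rpow (by norm_num) (by exact_mod_cast hN), hs,
      Real.rpow_add (by norm_num), Real.rpow_natCast, Real.rpow_one]
    exact mul_le_mul_of_nonneg_left h2 (by positivity)
  linarith

theorem tendsto_logb_div_atTop : Tendsto (fun x : ℝ => Real.logb 2 x / x) atTop (𝓝 0) := by
  have h := (Real.isLittleO_log_id_atTop.tendsto_div_nhds_zero).div_const (Real.log 2)
  simp only [zero_div] at h
  refine h.congr fun x => ?_
  rw [Real.logb, id, div_right_comm]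

theorem tendsto_logb_atTop : Tendsto (Real.logb 2) atTop atTop :=
  Real.tendsto_logb_atTop (by norm_num)

/-- What is needed about a branch with `m` elements and deficit `d`. -/
structure BranchBound (c : ℝ) (M : ℕ) (η : ℝ) (m : ℕ) (d : ℝ) : Prop where
  half_le : 1 / 2 ≤ d
  logb_le : Real.logb 2 (1 + c * m) ≤ d
  minLine_le : M ≤ m → minLine ((m : ℝ) ^ 2) - η ≤ d

theorem exists_minLine_sub_le {η : ℝ} (hη : 0 < η) : ∃ M : ℕ, ∀ m N : ℕ, M ≤ m → 0 < N →
    minLine ((m : ℝ) ^ 2) - η ≤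
      logInterp N + (max 0 ((m : ℝ) - 3 * Real.logb 2 N)) ^ 2 / (2 * N) := by
  have t1 : Tendsto (fun x : ℝ => 1 - 12 * (Real.logb 2 x / x)) atTop (𝓝 1) := by
    simpa using (tendsto_logb_div_atTop.const_mul 12).const_sub 1
  have t2 : Tendsto (fun x : ℝ => (1 - 12 * (Real.logb 2 x / x))⁻¹ ^ 2 - 1) atTop (𝓝 0) := by
    simpa using ((t1.inv₀ one_ne_zero).pow 2).sub_const 1
  have ev : ∀ᶠ x : ℝ in atTop, 0 < x ∧ 2 ≤ Real.logb 2 x ∧ 0 < 1 - 12 * (Real.logb 2 x / x) ∧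
      (1 - 12 * (Real.logb 2 x / x))⁻¹ ^ 2 - 1 < η := by
    filter_upwards [eventually_gt_atTop 0, tendsto_logb_atTop.eventually_ge_atTop 2,
      t1.eventually_const_lt one_pos, t2.eventually_lt_const hη] with x h1 h2 h3 h4
    exact ⟨h1, h2, h3, h4⟩
  obtain ⟨M, hM⟩ := eventually_atTop.1 (tendsto_natCast_atTop_atTop.eventually ev)
  refine ⟨M, fun m N hm hN => ?_⟩
  obtain ⟨h1, h2, h3, h4⟩ := hM m hm
  have hN' : (0 : ℝ) < N := by exact_mod_cast hN
  -- If `N ≥ m ^ 4`, the logarithmic term alone exceeds `minLine (m²)`, which is at most `log₂ m +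
  -- 1`. Otherwise `m - 3 log₂ N ≥ m - 12 log₂ m = m * q` with `q` close to 1, and replacing `m` by
  -- `m * q` costs less than `η`.
  rcases le_or_gt (4 * Real.logb 2 m) (Real.logb 2 N) with h | h
  · have a := minLine_le_logb (y := (m : ℝ) ^ 2) (by positivity)
    rw [Real.logb_pow] at a
    have b := logb_sub_le_logInterp hN
    have : 0 ≤ (max 0 ((m : ℝ) - 3 * Real.logb 2 N)) ^ 2 / (2 * N) := by positivity
    push_cast at a
    linarith
  · set q := 1 - 12 * (Real.logb 2 m / m) with hq
    have hρ : (m : ℝ) * q = m - 12 * Real.logb 2 m := by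
      rw [hq]; field_simp
    have hρ0 : 0 < (m : ℝ) * q := by positivity
    have a := minLine_le_logInterp_add hN (y := ((m : ℝ) * q) ^ 2) (by positivity)
    have hq1 : q ≤ 1 := by
      have : 0 ≤ Real.logb 2 m / m := div_nonneg (by linarith) h1.le
      rw [hq]; linarith
    have b := minLine_le_add (y := (m : ℝ) ^ 2) (z := ((m : ℝ) * q) ^ 2) (by positivity)
      (by positivity) (by rw [mul_pow]; nlinarith [sq_nonneg (m : ℝ)])
    have e : ((m : ℝ) ^ 2 - ((m : ℝ) * q) ^ 2) / ((m : ℝ) * q) ^ 2 = q⁻¹ ^ 2 - 1 := by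
      field_simp
    have le : ((m : ℝ) * q) ^ 2 / (2 * N) ≤
        (max 0 ((m : ℝ) - 3 * Real.logb 2 N)) ^ 2 / (2 * N) := by
      gcongr
      exact le_max_of_le_right (by linarith)
    rw [e] at b
    linarith

/-- Three estimates for three uses: the constant `1 / 2` for tiny branches, a concave logarithmic
bound that can be summed over branches of any size, and the sharp `minLine` bound for large
branches. -/
theorem exists_branchBound {η : ℝ} (hη : 0 < η) : ∃ (c : ℝ) (M : ℕ), 0 < c ∧
    ∀ (m N : ℕ), 2 ≤ N → BranchBound c M η m
      (logInterp N + (max 0 ((m : ℝ) - 3 * Real.logb 2 N)) ^ 2 / (2 * N)) := by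
  obtain ⟨M₀, hM₀⟩ := exists_minLine_sub_le hη
  obtain ⟨M₁, hM₁⟩ := exists_minLine_sub_le one_pos
  set K := max M₁ 4 with hK
  have hK4 : (4 : ℝ) ≤ K := by exact_mod_cast le_max_right M₁ 4
  -- This `c` makes `1 + c * m ≤ 5 / 4 ≤ √2` for `m ≤ K`, so the constant bound `1 / 2` covers small
  -- branches; for larger `m`, `1 + c * m ≤ m / 2` matches the bound `log₂ m - 1`.
  refine ⟨1 / (4 * K), M₀, by positivity, fun m N hN => ⟨?_, ?_, fun hm => hM₀ m N hm (by omega)⟩⟩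
  · have := half_le_logInterp hN
    have : 0 ≤ (max 0 ((m : ℝ) - 3 * Real.logb 2 N)) ^ 2 / (2 * N) := by positivity
    linarith
  · have hm0 : (0 : ℝ) ≤ m := Nat.cast_nonneg _
    have e : 1 / (4 * (K : ℝ)) * m = m / (4 * K) := by ring
    rw [e]
    rcases le_or_gt K m with h | h
    · have hm : (K : ℝ) ≤ m := by exact_mod_cast h
      have a := hM₁ m N ((le_max_left _ _).trans h) (by omega)
      have b := logb_le_minLine ((m : ℝ) ^ 2)
      rw [Real.logb_pow] at b
      have : Real.logb 2 (1 + m / (4 * K)) ≤ Real.logb 2 (m / 2) := by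
        refine Real.logb_le_logb_of_le (by norm_num) (by positivity) ?_
        have : (m : ℝ) / (4 * K) ≤ m / 16 := by
          refine div_le_div_of_nonneg_left hm0 (by norm_num) (by linarith)
        linarith
      rw [Real.logb_div (by linarith) (by norm_num), Real.logb_self_eq_one (by norm_num)] at this
      push_cast at b
      linarith
    · have hm : (m : ℝ) ≤ K := by exact_mod_cast h.le
      have a : Real.logb 2 (1 + m / (4 * K)) ≤ 1 / 2 := by
        rw [Real.logb_le_iff_le_rpow (by norm_num) (by positivity), ← Real.sqrt_eq_rpow]
        refine Real.le_sqrt_of_sq_le ?_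
        have : (m : ℝ) / (4 * K) ≤ 1 / 4 := by
          rw [div_le_iff₀ (by positivity)]; linarith
        have : (0 : ℝ) ≤ m / (4 * K) := by positivity
        nlinarith
      have := half_le_logInterp hN
      have : 0 ≤ (max 0 ((m : ℝ) - 3 * Real.logb 2 N)) ^ 2 / (2 * N) := by positivity
      linarith

theorem BranchBound.mono {c : ℝ} {M : ℕ} {η : ℝ} {m : ℕ} {d d' : ℝ}
    (h : BranchBound c M η m d) (hd : d ≤ d') : BranchBound c M η m d' :=
  ⟨h.half_le.trans hd, h.logb_le.trans hd, fun hm => (h.minLine_le hm).trans hd⟩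

end SubtreeOrder

/-! ### Distribution of the vertices among the branches -/

namespace SubtreeOrder

universe u

open Finset Filter Topology

/-- Concavity of the logarithm, in the form of Bernoulli's inequality: splitting a fixed mass into
pieces of size at most `X` costs at least as much as using pieces of size exactly `X`. -/
theorem div_mul_logb_le {c x X : ℝ} (hc : 0 < c) (hX : 0 < X) (hx : 0 ≤ x) (hxX : x ≤ X) :
    x / X * Real.logb 2 (1 + c * X) ≤ Real.logb 2 (1 + c * x) := by
  rw [← Real.logb_rpow_eq_mul_logb_of_pos (by positivity)]
  refine Real.logb_le_logb_of_le (by norm_num) (by positivity) ?_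
  refine (rpow_one_add_le_one_add_mul_self (by nlinarith [mul_pos hc hX]) (by positivity)
    ((div_le_one hX).2 hxX)).trans (le_of_eq ?_)
  field_simp

section Branches

variable {ι : Type*} {c η : ℝ} {M : ℕ} {m : ι → ℕ} {d : ι → ℝ}

theorem sum_mul_logb_le_sum {s : Multiset ι} (hc : 0 < c) {X : ℝ} (hX : 0 < X)
    (hs : ∀ i ∈ s, BranchBound c M η (m i) (d i)) (hm : ∀ i ∈ s, (m i : ℝ) ≤ X) :
    ((s.map m).sum : ℝ) / X * Real.logb 2 (1 + c * X) ≤ (s.map d).sum := by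
  induction s using Multiset.induction with
  | empty => simp
  | cons i s ih =>
    have h1 := ih (fun j hj => hs j (Multiset.mem_cons_of_mem hj))
      (fun j hj => hm j (Multiset.mem_cons_of_mem hj))
    have h2 := div_mul_logb_le hc hX (Nat.cast_nonneg (m i)) (hm i (Multiset.mem_cons_self i s))
    have h3 := (hs i (Multiset.mem_cons_self i s)).logb_le
    simp only [Multiset.map_cons, Multiset.sum_cons]
    rw [Nat.cast_add, add_div, add_mul]
    linarith

theorem half_le_sum {s : Multiset ι} (hs : ∀ i ∈ s, BranchBound c M η (m i) (d i))
    (h0 : s ≠ 0) : 1 / 2 ≤ (s.map d).sum := by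
  obtain ⟨i, hi⟩ := Multiset.exists_mem_of_ne_zero h0
  refine (hs i hi).half_le.trans (Multiset.single_le_sum ?_ _ (Multiset.mem_map_of_mem d hi))
  intro x hx
  obtain ⟨j, hj, rfl⟩ := Multiset.mem_map.1 hx
  linarith [(hs j hj).half_le]

/-- The cases depend on the second largest branch and on the mass outside the two largest.
Spread-out mass gives at least `(2 + 1/25) * L`, where `L` is about `log₂ n`, beating the target;
otherwise two branches of nearly half size carry the sharp bound. -/
theorem eventually_of_sum_branches (hc : 0 < c) (M : ℕ) (hη : 0 < η) :
    ∀ᶠ n : ℕ in atTop, ∀ (ι : Type u) (s : Multiset ι) (m : ι → ℕ) (d : ι → ℝ),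
      (∀ i ∈ s, BranchBound c M η (m i) (d i)) → (∀ i ∈ s, 2 * m i ≤ n) →
      (s.map m).sum + 1 = n → 2 * minLine ((n : ℝ) ^ 2 / 4) - 4 * η ≤ (s.map d).sum := by
  have tinv : Tendsto (fun x : ℝ => (1 - 2 / x)⁻¹ ^ 2 - 1) atTop (𝓝 0) := by
    have : Tendsto (fun x : ℝ => 1 - 2 / x) atTop (𝓝 1) := by
      simpa using (tendsto_const_nhds.div_atTop tendsto_id).const_sub (1 : ℝ)
    simpa using ((this.inv₀ one_ne_zero).pow 2).sub_const 1
  -- The factor 51 makes `2 log₂ x ≤ (51/25) * L`; the condition on `M` makes the sharp bound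
  -- available from `47/100 * x` on.
  have ev : ∀ᶠ x : ℝ in atTop, 100 ≤ x ∧ 100 * (M : ℝ) ≤ 47 * x ∧
      -51 * Real.logb 2 (c / 8) ≤ Real.logb 2 x ∧ (1 - 2 / x)⁻¹ ^ 2 - 1 < η := by
    filter_upwards [eventually_ge_atTop 100, eventually_ge_atTop (100 * (M : ℝ) / 47),
      tendsto_logb_atTop.eventually_ge_atTop (-51 * Real.logb 2 (c / 8)),
      tinv.eventually_lt_const hη] with x h1 h2 h3 h4
    exact ⟨h1, by linarith, h3, h4⟩
  filter_upwards [tendsto_natCast_atTop_atTop.eventually ev] with n hn ι s m d hs hm hsum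
  obtain ⟨n100, hnM, hlog, hinv⟩ := hn
  have hn0 : (0 : ℝ) < n := by linarith
  set x : ℝ := (n : ℝ) with hx
  have target_le : minLine (x ^ 2 / 4) ≤ Real.logb 2 x := by
    have h := minLine_le_logb (y := x ^ 2 / 4) (by positivity)
    have e : x ^ 2 / 4 = (x / 2) ^ 2 := by ring
    rw [e, Real.logb_pow, Real.logb_div hn0.ne' (by norm_num),
      Real.logb_self_eq_one (by norm_num)] at h
    push_cast at h
    rw [e]
    linarith
  set L := Real.logb 2 (1 + c * (x / 8)) with hL
  have hL1 : Real.logb 2 x + Real.logb 2 (c / 8) ≤ L := by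
    rw [← Real.logb_mul hn0.ne' (by positivity)]
    exact Real.logb_le_logb_of_le (by norm_num) (by positivity) (by nlinarith)
  have hL0 : 0 ≤ L := Real.logb_nonneg (by norm_num) (by nlinarith [mul_pos hc hn0])
  have hLtarget : 2 * minLine (x ^ 2 / 4) ≤ (2 + 1 / 25) * L := by linarith
  have hmR : ∀ i ∈ s, (m i : ℝ) ≤ x / 2 := by
    intro i hi
    have : (2 : ℝ) * m i ≤ x := by rw [hx]; exact_mod_cast hm i hi
    linarith
  have hs0 : s ≠ 0 := by
    rintro rfl
    simp at hsum
    have : (n : ℝ) = 1 := by rw [← hsum]; norm_num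
    linarith
  obtain ⟨i, hi, himax⟩ := Multiset.exists_max_image m hs0
  obtain ⟨t, rfl⟩ := Multiset.exists_cons_of_mem hi
  have hsum' : (m i : ℝ) + ((t.map m).sum : ℕ) + 1 = x := by
    rw [hx, ← hsum]
    simp
  have hi2 := hmR i hi
  have hBi := hs i hi
  have hBt : ∀ j ∈ t, BranchBound c M η (m j) (d j) :=
    fun j hj => hs j (Multiset.mem_cons_of_mem hj)
  have ht0 : t ≠ 0 := by
    rintro rfl
    simp at hsum'
    linarith
  obtain ⟨j, hj, hjmax⟩ := Multiset.exists_max_image m ht0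
  simp only [Multiset.map_cons, Multiset.sum_cons]
  -- All branches but the largest are at most `x / 8` and together hold at least `3x / 8`,
  -- contributing `3 * L`.
  rcases le_or_gt (m j : ℝ) (x / 8) with hjs | hjl
  · have h := sum_mul_logb_le_sum hc (by positivity : 0 < x / 8) hBt
      (fun k hk => le_trans (by exact_mod_cast hjmax k hk) hjs)
    rw [← hL] at h
    have h3 : 3 ≤ (((t.map m).sum : ℕ) : ℝ) / (x / 8) := by
      rw [le_div_iff₀ (by positivity)]; linarith
    have := mul_le_mul_of_nonneg_right h3 hL0
    linarith [hBi.half_le]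
  have hij : m j ≤ m i := himax j (Multiset.mem_cons_of_mem hj)
  have hj2 := hmR j (Multiset.mem_cons_of_mem hj)
  obtain ⟨u, rfl⟩ := Multiset.exists_cons_of_mem hj
  have hBj := hBt j hj
  have hBu : ∀ k ∈ u, BranchBound c M η (m k) (d k) :=
    fun k hk => hBt k (Multiset.mem_cons_of_mem hk)
  have hsum'' : (m i : ℝ) + m j + ((u.map m).sum : ℕ) + 1 = x := by
    rw [← hsum']
    simp
    ring
  simp only [Multiset.map_cons, Multiset.sum_cons]
  have hijR : (m j : ℝ) ≤ m i := by exact_mod_cast hij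
  have monoL : ∀ y : ℝ, x / 8 ≤ y → L ≤ Real.logb 2 (1 + c * y) := by
    intro y hy
    exact Real.logb_le_logb_of_le (by norm_num) (by positivity) (by gcongr)
  -- The two largest branches give `2 * L`; mass `x / 50` in pieces of size at most `x / 2` gives
  -- the missing `L / 25`.
  rcases le_or_gt (x / 50) ((u.map m).sum : ℕ) with hul | hus
  · have h := sum_mul_logb_le_sum hc (by positivity : 0 < x / 2) hBu
      (fun k hk => hmR k (Multiset.mem_cons_of_mem (Multiset.mem_cons_of_mem hk)))
    have h1 : 1 / 25 ≤ (((u.map m).sum : ℕ) : ℝ) / (x / 2) := by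
      rw [le_div_iff₀ (by positivity)]; linarith
    have h2 := monoL (x / 2) (by linarith)
    have h3 := monoL (m i) (by linarith)
    have h4 := monoL (m j) (by linarith)
    have h5 := mul_le_mul h1 h2 hL0 (by linarith)
    linarith [hBi.logb_le, hBj.logb_le]
  · have hi47 : 47 / 100 * x ≤ m i := by linarith
    have hj47 : 47 / 100 * x ≤ m j := by linarith
    have hMi : M ≤ m i := by
      have : (M : ℝ) ≤ m i := by linarith
      exact_mod_cast this
    have hMj : M ≤ m j := by
      have : (M : ℝ) ≤ m j := by linarith
      exact_mod_cast this
    have hgi := hBi.minLine_le hMi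
    have hgj := hBj.minLine_le hMj
    -- With no third branch, both sizes are at least `x / 2 - 1`. With one, its deficit of at least
    -- `1 / 2` compensates the loss of at most `1 / 4` on each large branch.
    rcases eq_or_ne u 0 with rfl | hu0
    · simp at hsum'' ⊢
      have h1 : ∀ y : ℝ, x / 2 - 1 ≤ y → minLine (x ^ 2 / 4) - η ≤ minLine (y ^ 2) := by
        intro y hy
        have a := minLine_le_add (y := x ^ 2 / 4) (z := (x / 2 - 1) ^ 2) (by positivity)
          (pow_pos (by linarith) 2) (by nlinarith)
        have b := minLine_mono (y := (x / 2 - 1) ^ 2) (z := y ^ 2) (pow_pos (by linarith) 2)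
          (pow_le_pow_left₀ (by linarith) hy 2)
        have e : (x ^ 2 / 4 - (x / 2 - 1) ^ 2) / (x / 2 - 1) ^ 2 = (1 - 2 / x)⁻¹ ^ 2 - 1 := by
          have : x - 2 ≠ 0 := by linarith
          have h' : x / 2 - 1 = (x - 2) / 2 := by ring
          have h'' : 1 - 2 / x = (x - 2) / x := by field_simp
          rw [h', h'']
          field_simp
          ring
        rw [e] at a
        linarith
      have h2 := h1 (m i) (by linarith)
      have h3 := h1 (m j) (by linarith)
      linarith
    · have hu := half_le_sum hBu hu0
      have h1 : ∀ y : ℝ, 47 / 100 * x ≤ y → minLine (x ^ 2 / 4) - 1 / 4 ≤ minLine (y ^ 2) := by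
        intro y hy
        have a := minLine_le_add (y := x ^ 2 / 4) (z := (47 / 100 * x) ^ 2) (by positivity)
          (by positivity) (by nlinarith)
        have b := minLine_mono (y := (47 / 100 * x) ^ 2) (z := y ^ 2) (by positivity)
          (pow_le_pow_left₀ (by positivity) hy 2)
        have e : (x ^ 2 / 4 - (47 / 100 * x) ^ 2) / (47 / 100 * x) ^ 2 ≤ 1 / 4 := by
          rw [div_le_iff₀ (by positivity)]
          nlinarith
        linarith
      have h2 := h1 (m i) hi47
      have h3 := h1 (m j) hj47
      linarith

end Branches

/-- Deficit bound for sets in a forest order without large parts above a single element. -/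
theorem eventually_minLine_le_lowerDeficit {η : ℝ} (hη : 0 < η) :
    ∀ᶠ n : ℕ in atTop, ∀ (V : Type u) (r : V → V → Prop) (A : Finset V), IsForestOrder r →
      A.card + 1 = n → (∀ B ⊆ A, (∃ u ∈ B, ∀ b ∈ B, r u b) → 2 * B.card ≤ n) →
      2 * minLine ((n : ℝ) ^ 2 / 4) - 4 * η ≤ lowerDeficit r A := by
  obtain ⟨c, M, hc, hB⟩ := exists_branchBound hη
  filter_upwards [eventually_of_sum_branches.{u} hc M hη] with n hn V r A hr hA hsmall
  obtain ⟨s, h1, h2, h3, h4⟩ := hr.exists_branches A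
  rw [← h4]
  refine hn (Finset V) s Finset.card (lowerDeficit r) (fun B hBs => ?_)
    (fun B hBs => hsmall B (h2 B hBs) (h1 B hBs)) (by rw [h3, hA])
  obtain ⟨u, hu, -⟩ := h1 B hBs
  exact (hB B.card _ (two_le_lowerCount ⟨u, hu⟩)).mono (logInterp_add_le_lowerDeficit hr B)

end SubtreeOrder

namespace SubtreeOrder

universe u

open Finset Filter Topology

/-! ### The order of a rooted tree -/

section Dominates

variable {V : Type u} {T : SimpleGraph V} {v : V}

/-- `x` lies on every walk from the root `v` to `w`. -/
def Dominates (T : SimpleGraph V) (v x w : V) : Prop := ∀ p : T.Walk v w, x ∈ p.support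

theorem dominates_of_isPath (hT : T.IsTree) {x w : V} {p : T.Walk v w} (hp : p.IsPath)
    (hx : x ∈ p.support) : Dominates T v x w := by
  classical
  intro q
  refine q.support_bypass_subset_support ?_
  have h : (⟨p, hp⟩ : T.Path v w) = ⟨q.bypass, q.bypass_isPath⟩ := 
    (hT.isAcyclic.subsingleton_path v w).elim _ _
  rw [← Subtype.mk.inj h]
  exact hx

theorem exists_isPath (hT : T.IsTree) (v w : V) : ∃ p : T.Walk v w, p.IsPath := by
  obtain ⟨p, hp, -⟩ := hT.existsUnique_path v w
  exact ⟨p, hp⟩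

/-- Two ancestors of `z` lie on the same path from the root, and the one met first is an ancestor of
the other. -/
theorem dominates_isForestOrder (hT : T.IsTree) (v : V) : IsForestOrder (Dominates T v) where
  refl x p := p.end_mem_support
  trans x y z hxy hyz p := by
    classical
    exact p.support_takeUntil_subset_support (hyz p) (hxy _)
  antisymm x y hxy hyx := by
    classical
    by_contra hne
    obtain ⟨p, hp⟩ := exists_isPath hT v x
    exact SimpleGraph.Walk.endpoint_notMem_support_takeUntil hp (hyx p) hne (hxy _)
  chain x y z hx hy := by
    obtain ⟨p, hp⟩ := exists_isPath hT v z
    obtain ⟨p₀, p₁, rfl⟩ := p.mem_support_iff_exists_append.1 (hx p)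
    rcases (p₀.mem_support_append_iff p₁).1 (hy _) with h | h
    · exact Or.inr (dominates_of_isPath hT hp.of_append_left h)
    · obtain ⟨a, b, rfl⟩ := p₁.mem_support_iff_exists_append.1 h
      rw [SimpleGraph.Walk.append_assoc] at hp
      refine Or.inl (dominates_of_isPath hT hp.of_append_left ?_)
      exact (SimpleGraph.Walk.mem_support_append_iff _ _).2 (Or.inl p₀.end_mem_support)

theorem exists_walk_of_induce {S : Set V} {a b : V} (ha : a ∈ S) (hb : b ∈ S)
    (h : (T.induce S).Reachable ⟨a, ha⟩ ⟨b, hb⟩) : ∃ p : T.Walk a b, ∀ x ∈ p.support, x ∈ S := by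
  obtain ⟨p⟩ := h
  have key : ∀ x ∈ (p.map (SimpleGraph.Embedding.induce S).toHom).support, x ∈ S := by
    intro x hx
    rw [SimpleGraph.Walk.support_map, List.mem_map] at hx
    obtain ⟨y, -, rfl⟩ := hx
    exact y.2
  exact ⟨p.map (SimpleGraph.Embedding.induce S).toHom, key⟩

/-- A walk inside `S` from the root to `x` meets every dominator of `x`. Conversely, the path from
the root to `x` consists of dominators of `x`, so it stays in `S`. -/
theorem connected_induce_iff (hT : T.IsTree) {S : Set V} (hv : v ∈ S) :
    (T.induce S).Connected ↔ ∀ x ∈ S, ∀ y, Dominates T v y x → y ∈ S := by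
  constructor
  · intro h x hx y hy
    obtain ⟨p, hp⟩ := exists_walk_of_induce hv hx (h.preconnected _ _)
    exact hp y (hy p)
  · intro h
    refine (SimpleGraph.connected_iff_exists_forall_reachable _).2 ⟨⟨v, hv⟩, ?_⟩
    rintro ⟨w, hw⟩
    obtain ⟨p, hp⟩ := exists_isPath hT v w
    exact ⟨p.induce S fun x hx => h w hw x (dominates_of_isPath hT hp hx)⟩

theorem dominates_root (x : V) : Dominates T v v x := fun p => p.start_mem_support

theorem dominates_or_of_adj (hT : T.IsTree) {a b : V} (h : T.Adj a b) :
    Dominates T v a b ∨ Dominates T v b a := by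
  obtain ⟨p, hp⟩ := exists_isPath hT v a
  by_cases hb : b ∈ p.support
  · exact Or.inr (dominates_of_isPath hT hp hb)
  · refine Or.inl (dominates_of_isPath hT (hp.concat hb h) ?_)
    exact p.support_subset_support_concat h p.end_mem_support

/-- Vertices above a non-root vertex `u` are connected to `u` outside the root. -/
theorem reachable_of_dominates (hT : T.IsTree) {x w : V} (hx : x ≠ v) (hw : w ≠ v)
    (h : Dominates T v x w) :
    (T.induce ({v}ᶜ : Set V)).Reachable ⟨x, hx⟩ ⟨w, hw⟩ := by
  obtain ⟨p, hp⟩ := exists_isPath hT v w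
  obtain ⟨p₀, p₁, rfl⟩ := p.mem_support_iff_exists_append.1 (h p)
  refine ⟨p₁.induce _ fun y hy => ?_⟩
  rintro rfl
  exact hp.ne_of_mem_support_of_append hx.symm p₀.start_mem_support hy rfl

end Dominates

/-! ### Subtrees through a vertex, and centroids -/

section Local

variable {V : Type u} [Fintype V] {T : SimpleGraph V} {v : V}

theorem mem_subtreesContaining {A S : Finset V} :
    S ∈ subtreesContaining T A ↔ A ⊆ S ∧ (T.induce (S : Set V)).Connected := by
  simp [subtreesContaining]

theorem subtreesContaining_singleton [DecidableEq V] (hT : T.IsTree) (v : V) :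
    subtreesContaining T {v} =
      (lowerFamily (Dominates T v) (univ.erase v)).image (insert v) := by
  have h := lowerFamily_plant (A := univ) (dominates_isForestOrder hT v) (mem_univ v)
    (fun a _ => dominates_root a)
  have h2 := congrArg (fun F => F.erase ∅) h
  rw [erase_insert (empty_notMem_image_insert _)] at h2
  rw [← h2]
  ext S
  rw [mem_subtreesContaining, singleton_subset_iff, mem_erase, mem_lowerFamily]
  constructor
  · rintro ⟨hv, h⟩
    rw [connected_induce_iff hT (v := v) (by simpa using hv)] at h
    exact ⟨ne_empty_of_mem hv, subset_univ _, fun x hx y _ hyx => by simpa using h x hx y hyx⟩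
  · rintro ⟨hne, -, h⟩
    obtain ⟨x, hx⟩ := nonempty_iff_ne_empty.2 hne
    have hv : v ∈ S := h x hx v (mem_univ v) (dominates_root x)
    refine ⟨hv, (connected_induce_iff hT (v := v) (by simpa using hv)).2 ?_⟩
    intro x hx y hyx
    exact h x hx y (mem_univ y) hyx

theorem localMeanSubtreeOrder_eq [DecidableEq V] (hT : T.IsTree) (v : V) :
    localMeanSubtreeOrder T v =
      Fintype.card V - lowerDeficit (Dominates T v) (univ.erase v) := by
  have hN : (0 : ℝ) < lowerCount (Dominates T v) (univ.erase v) := by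
    exact_mod_cast lowerCount_pos _
  rw [localMeanSubtreeOrder, meanOrderContaining, subtreesContaining_singleton hT v,
    card_image_of_injOn insert_injOn_lowerFamily_erase,
    sum_image insert_injOn_lowerFamily_erase, ← lowerCount, lowerDeficit]
  have : ∀ S ∈ lowerFamily (Dominates T v) (univ.erase v), ((insert v S).card : ℝ) =
      Fintype.card V - (((univ.erase v).card : ℝ) - S.card) := by
    intro S hS
    rw [card_insert_of_notMem (notMem_of_mem_lowerFamily_erase hS), ← card_univ,
      ← card_erase_add_one (mem_univ v)]
    push_cast
    ring
  rw [sum_congr rfl this, sum_sub_distrib, ← lowerMissing, sum_const, nsmul_eq_mul, ← lowerCount]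
  field_simp

theorem IsCentroid.two_mul_card_le (hv : IsCentroid T v) {B : Finset V}
    (C : (T.induce ({v}ᶜ : Set V)).ConnectedComponent)
    (hB : ∀ b ∈ B, ∃ hb : b ∈ ({v}ᶜ : Set V),
      (T.induce ({v}ᶜ : Set V)).connectedComponentMk ⟨b, hb⟩ = C) :
    2 * B.card ≤ Fintype.card V := by
  refine le_trans (Nat.mul_le_mul_left 2 ?_) (hv C)
  rw [← Set.ncard_coe_finset, ← Set.ncard_image_of_injective C.supp Subtype.val_injective]
  refine Set.ncard_le_ncard (fun b hb => ?_) (Set.toFinite _)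
  obtain ⟨h, hC⟩ := hB b hb
  exact ⟨⟨b, h⟩, hC, rfl⟩

theorem IsCentroid.two_mul_card_le_of_dominates (hT : T.IsTree) (hv : IsCentroid T v)
    {B : Finset V} (hvB : v ∉ B) {x : V} (hx : x ∈ B) (h : ∀ b ∈ B, Dominates T v x b) :
    2 * B.card ≤ Fintype.card V := by
  have hne : ∀ b ∈ B, b ≠ v := fun b hb hbv => hvB (hbv ▸ hb)
  refine hv.two_mul_card_le (SimpleGraph.connectedComponentMk _ ⟨x, hne x hx⟩) fun b hb => ?_
  refine ⟨hne b hb, SimpleGraph.ConnectedComponent.eq.2 ?_⟩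
  exact (reachable_of_dominates hT (hne x hx) (hne b hb) (h b hb)).symm

theorem IsCentroid.two_mul_card_le_of_connected (hv : IsCentroid T v) {S : Finset V}
    (hvS : v ∉ S) (hS : (T.induce (S : Set V)).Connected) : 2 * S.card ≤ Fintype.card V := by
  have hne : ∀ b ∈ S, b ≠ v := fun b hb hbv => hvS (hbv ▸ hb)
  obtain ⟨⟨x, hx⟩⟩ := hS.nonempty
  refine hv.two_mul_card_le (SimpleGraph.connectedComponentMk _ ⟨x, hne x hx⟩) fun b hb => ?_
  refine ⟨hne b hb, SimpleGraph.ConnectedComponent.eq.2 ?_⟩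
  obtain ⟨p, hp⟩ := exists_walk_of_induce (mem_coe.2 hb) hx (hS.preconnected _ _)
  exact ⟨p.induce _ fun y hy => hne y (hp y hy)⟩

/-- Root the tree anywhere and take a vertex `x` with the smallest set of descendants that still
exceeds half of the tree. Components below `x` lie in a smaller descendant set, and the others avoid
the descendants of `x`; either way they have at most half of the vertices. -/
theorem exists_isCentroid (hT : T.IsTree) : ∃ v, IsCentroid T v := by
  classical
  obtain ⟨r⟩ := hT.connected.nonempty
  have hr := dominates_isForestOrder hT r
  set up : V → Finset V := fun x => univ.filter (Dominates T r x) with hup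
  have mem_up : ∀ {x w}, w ∈ up x ↔ Dominates T r x w := by simp [hup]
  have up_lt : ∀ {x y}, Dominates T r x y → x ≠ y → (up y).card < (up x).card := by
    intro x y hxy hne
    refine card_lt_card ((ssubset_iff_of_subset fun w hw => ?_).2 ⟨x, ?_, fun h => ?_⟩)
    · exact mem_up.2 (hr.trans _ _ _ hxy (mem_up.1 hw))
    · exact mem_up.2 (hr.refl x)
    · exact hne (hr.antisymm _ _ hxy (mem_up.1 h))
  have hne : (univ.filter fun x => Fintype.card V < 2 * (up x).card).Nonempty := by
    refine ⟨r, mem_filter.2 ⟨mem_univ _, ?_⟩⟩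
    have : up r = univ := by
      ext w
      simp [mem_up, dominates_root]
    rw [this, card_univ]
    have := Fintype.card_pos_iff.2 ⟨r⟩
    omega
  obtain ⟨x, hx, hmin⟩ := exists_min_image _ (fun x => (up x).card) hne
  simp only [mem_filter, mem_univ, true_and] at hx hmin
  refine ⟨x, fun C => ?_⟩
  set U : Finset V := univ.filter fun w => ∃ h : w ∈ ({x}ᶜ : Set V),
    (T.induce ({x}ᶜ : Set V)).connectedComponentMk ⟨w, h⟩ = C with hU
  have hUcard : C.supp.ncard = U.card := by
    rw [← Set.ncard_image_of_injective C.supp Subtype.val_injective, ← Set.ncard_coe_finset]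
    congr 1
    ext w
    simp [hU, SimpleGraph.ConnectedComponent.mem_supp_iff]
  have mem_U : ∀ {w}, w ∈ U ↔ ∃ h : w ∈ ({x}ᶜ : Set V),
    (T.induce ({x}ᶜ : Set V)).connectedComponentMk ⟨w, h⟩ = C := by simp [hU]
  rw [hUcard]
  by_cases hsub : U ⊆ up x
  · have hUne : U.Nonempty := by
      obtain ⟨⟨w, hw⟩, hC⟩ := C.nonempty_supp
      exact ⟨w, mem_U.2 ⟨hw, hC⟩⟩
    obtain ⟨y, hy, hmax⟩ := exists_max_image U (fun y => (up y).card) hUne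
    obtain ⟨hyx, hyC⟩ := mem_U.1 hy
    have hUy : U ⊆ up y := by
      intro w hw
      by_contra hwy
      obtain ⟨hwx, hwC⟩ := mem_U.1 hw
      obtain ⟨p⟩ := SimpleGraph.ConnectedComponent.eq.1 (hyC.trans hwC.symm)
      -- A walk in the component leaving the descendants of `y` must step to a proper ancestor of
      -- `y`, which would have a larger descendant set than the maximal one.
      obtain ⟨d, hd, hd1, hd2⟩ := p.exists_boundary_dart {z | Dominates T r y z.1} (hr.refl y)
        (fun h => hwy (mem_up.2 h))
      have hadj : T.Adj d.fst.1 d.snd.1 := d.adj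
      have hb : d.snd.1 ∈ U := by
        refine mem_U.2 ⟨d.snd.2, ?_⟩
        rw [← hyC]
        refine SimpleGraph.ConnectedComponent.eq.2 (SimpleGraph.Reachable.symm ?_)
        exact ⟨p.takeUntil _ (p.dart_snd_mem_support_of_mem_darts hd)⟩
      have hba : Dominates T r d.snd.1 d.fst.1 :=
        (dominates_or_of_adj hT hadj).resolve_left fun h => hd2 (hr.trans _ _ _ hd1 h)
      have hby : Dominates T r d.snd.1 y := (hr.chain _ _ _ hd1 hba).resolve_left hd2
      refine (hmax _ hb).not_gt (up_lt hby ?_)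
      intro h
      exact hd2 (h ▸ hr.refl y)
    have hlt := up_lt (mem_up.1 (hsub hy)) (Ne.symm hyx)
    have h1 : ¬ Fintype.card V < 2 * (up y).card := fun h => (hmin y h).not_gt hlt
    have h2 := card_le_card hUy
    omega
  · obtain ⟨w, hw, hwx⟩ := not_subset.1 hsub
    have hdisj : U ⊆ (up x)ᶜ := by
      intro z hz
      rw [mem_compl]
      intro hzx
      rw [mem_up] at hwx hzx
      -- A walk from the root to `w` avoiding `x`, continued inside the component, reaches `z`
      -- without meeting `x`.
      rw [Dominates, not_forall] at hwx
      obtain ⟨p, hp⟩ := hwx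
      obtain ⟨h1, h1C⟩ := mem_U.1 hw
      obtain ⟨h2, h2C⟩ := mem_U.1 hz
      obtain ⟨q, hq⟩ := exists_walk_of_induce h1 h2
        (SimpleGraph.ConnectedComponent.eq.1 (h1C.trans h2C.symm))
      rcases (SimpleGraph.Walk.mem_support_append_iff p q).1 (hzx (p.append q)) with h | h
      · exact hp h
      · exact hq x h rfl
    have h3 := card_le_card hdisj
    rw [card_compl] at h3
    have h4 := card_le_univ (up x)
    omega

end Local

/-! ### Upper bounds for the local and global mean subtree order -/

/-- Dividing by 4 shifts the logarithm by 2, a whole number of periods of `f`. -/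
theorem two_mul_minLine {n : ℕ} (hn : 0 < n) : 2 * minLine ((n : ℝ) ^ 2 / 4) =
    2 * Real.logb 2 n - 2 - f (2 * Real.logb 2 n) := by
  have hn' : (n : ℝ) ≠ 0 := by exact_mod_cast hn.ne'
  have e : Real.logb 2 ((n : ℝ) ^ 2 / 4) = 2 * Real.logb 2 n - (2 : ℕ) * 1 := by
    have e4 : (n : ℝ) ^ 2 / 4 = (n / 2) ^ 2 := by ring
    rw [e4, Real.logb_pow, Real.logb_div hn' (by norm_num), Real.logb_self_eq_one (by norm_num)]
    push_cast
    ring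
  rw [minLine, e, f_periodic.sub_nat_mul_eq]
  push_cast
  ring

theorem eventually_localMeanSubtreeOrder_le {η : ℝ} (hη : 0 < η) :
    ∀ᶠ n : ℕ in atTop, ∀ (V : Type u) [Fintype V] (T : SimpleGraph V) (v : V),
      Fintype.card V = n → T.IsTree → IsCentroid T v → localMeanSubtreeOrder T v ≤
        (n : ℝ) - 2 * Real.logb 2 n + 2 + f (2 * Real.logb 2 n) + η := by
  filter_upwards [eventually_minLine_le_lowerDeficit.{u} (by positivity : 0 < η / 4),
    eventually_gt_atTop 0] with n hn hn0 V _ T v hcard hT hv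
  classical
  have h := hn V (Dominates T v) (univ.erase v) (dominates_isForestOrder hT v)
    (by rw [card_erase_add_one (mem_univ v), card_univ, hcard])
    (fun B hB ⟨x, hx, hxB⟩ => hcard ▸ hv.two_mul_card_le_of_dominates hT
      (fun hvB => by simpa using hB hvB) hx hxB)
  rw [two_mul_minLine hn0] at h
  rw [localMeanSubtreeOrder_eq hT v, hcard]
  linarith

theorem meanOrderContaining_le_card {V : Type u} [Fintype V] (T : SimpleGraph V) (A : Finset V) :
    meanOrderContaining T A ≤ Fintype.card V := by
  rw [meanOrderContaining]
  refine div_le_of_le_mul₀ (Nat.cast_nonneg _) (Nat.cast_nonneg _) ?_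
  rw [mul_comm, ← nsmul_eq_mul]
  refine sum_le_card_nsmul _ _ _ fun S _ => ?_
  exact_mod_cast card_le_univ S

/-- A subtree avoiding the centroid lies in one component, so it has at most half of the vertices
and cannot raise the average above `b`. -/
theorem meanSubtreeOrder_le_of_isCentroid {V : Type u} [Fintype V] {T : SimpleGraph V} {v : V}
    (hv : IsCentroid T v) {b : ℝ} (hb : localMeanSubtreeOrder T v ≤ b)
    (hb' : (Fintype.card V : ℝ) / 2 ≤ b) : meanSubtreeOrder T ≤ b := by
  classical
  have hb0 : 0 ≤ b := le_trans (by positivity) hb'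
  rw [meanSubtreeOrder, meanOrderContaining]
  refine div_le_of_le_mul₀ (Nat.cast_nonneg _) hb0 ?_
  have hpos : ∀ S ∈ (subtreesContaining T ∅).filter (fun S => ¬ v ∈ S), (S.card : ℝ) ≤ b := by
    intro S hS
    rw [mem_filter, mem_subtreesContaining] at hS
    have h : (2 : ℝ) * S.card ≤ Fintype.card V := by
      exact_mod_cast hv.two_mul_card_le_of_connected hS.2 hS.1.2
    linarith
  have hfil : (subtreesContaining T ∅).filter (fun S => v ∈ S) = subtreesContaining T {v} := by
    ext S
    simp [mem_subtreesContaining, and_comm]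
  rw [← sum_filter_add_sum_filter_not _ (fun S => v ∈ S),
    ← card_filter_add_card_filter_not (s := subtreesContaining T ∅) (fun S => v ∈ S)]
  have h1 := sum_le_card_nsmul _ _ _ hpos
  rw [nsmul_eq_mul] at h1
  rw [hfil] at *
  rw [localMeanSubtreeOrder, meanOrderContaining] at hb
  have h2 : ∑ S ∈ subtreesContaining T {v}, (S.card : ℝ) ≤ b * (subtreesContaining T {v}).card := by
    rcases (subtreesContaining T {v}).eq_empty_or_nonempty with h | h
    · simp [h]
    · rwa [div_le_iff₀ (by exact_mod_cast card_pos.2 h)] at hb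
  push_cast
  linarith

end SubtreeOrder

namespace SubtreeOrder

open Finset

/-! ### Double brooms -/

section DoubleBroom

variable {n k : ℕ}

/-- The level of a vertex in the double broom: the first `k` vertices have level `0`, the last `k`
vertices have level `n - 2 * k + 1`, and the other vertices have consecutive levels between. -/
def level (n k : ℕ) (x : Fin n) : ℕ := min (x + 1 - k) (n - 2 * k + 1)

/-- The tree that consists of a path on `n - 2 * k` vertices with `k` leaves attached to either
end. -/
def doubleBroom (n k : ℕ) : SimpleGraph (Fin n) where
  Adj x y := level n k x + 1 = level n k y ∨ level n k y + 1 = level n k x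
  symm := ⟨fun _ _ h => Or.symm h⟩
  loopless := ⟨fun x h => by omega⟩

/-- The vertices on the path of the double broom. -/
def spine (n k : ℕ) : Finset (Fin n) := univ.filter fun x => k ≤ x.1 ∧ x.1 < n - k

theorem mem_spine {x : Fin n} : x ∈ spine n k ↔ k ≤ x.1 ∧ x.1 < n - k := by
  simp [spine]

theorem doubleBroom_adj {x y : Fin n} : (doubleBroom n k).Adj x y ↔
    level n k x + 1 = level n k y ∨ level n k y + 1 = level n k x := Iff.rfl

/-- The neighbour of a vertex `x ≠ k` in the direction of the vertex `k`. -/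
def parent (n k : ℕ) (hk : 2 * k < n) (x : Fin n) : Fin n :=
  if x.1 < k then ⟨k, by omega⟩ else ⟨min (x - 1) (n - k - 1), by omega⟩

theorem parent_mem_spine (hk : 2 * k < n) {x : Fin n} (hx : x.1 ≠ k) :
    parent n k hk x ∈ spine n k := by
  rw [mem_spine, parent]
  split_ifs <;> simp only <;> omega

theorem adj_parent (hk : 2 * k < n) {x : Fin n} (hx : x.1 ≠ k) :
    (doubleBroom n k).Adj x (parent n k hk x) := by
  rw [doubleBroom_adj, parent, level, level]
  have := x.2
  split_ifs <;> simp only <;> omega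

theorem connected_induce_of_spine_subset (hk : 2 * k < n) {S : Set (Fin n)}
    (hS : (spine n k : Set (Fin n)) ⊆ S) : ((doubleBroom n k).induce S).Connected := by
  have hroot : (⟨k, by omega⟩ : Fin n) ∈ S := hS (mem_coe.2 (mem_spine.2 (by simp; omega)))
  refine (SimpleGraph.connected_iff_exists_forall_reachable _).2 ⟨⟨_, hroot⟩, ?_⟩
  -- Adding `n` for the lower leaves places them after the spine in the induction, so that `parent`
  -- always decreases the measure.
  have key : ∀ m : ℕ, ∀ x : Fin n, ∀ hx : x ∈ S, x.1 + (if x.1 < k then n else 0) ≤ m →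
      ((doubleBroom n k).induce S).Reachable ⟨_, hroot⟩ ⟨x, hx⟩ := by
    intro m
    induction m with
    | zero =>
      intro x hx hm
      have hxk : k = x.1 := by split_ifs at hm <;> omega
      exact (Subtype.ext (Fin.ext hxk) : (⟨_, hroot⟩ : S) = ⟨x, hx⟩) ▸
        SimpleGraph.Reachable.refl _
    | succ m ih =>
      intro x hx hm
      by_cases hxk : x.1 = k
      · exact (Subtype.ext (Fin.ext hxk.symm) : (⟨_, hroot⟩ : S) = ⟨x, hx⟩) ▸
          SimpleGraph.Reachable.refl _
      have hp := hS (parent_mem_spine hk hxk)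
      refine (ih (parent n k hk x) hp ?_).trans (SimpleGraph.Adj.reachable ?_)
      · have := x.2
        rw [parent]
        split_ifs at hm ⊢ <;> simp only at * <;> omega
      · exact (adj_parent hk hxk).symm
  exact fun ⟨x, hx⟩ => key _ x hx le_rfl

theorem doubleBroom_isTree (hk : 2 * k < n) : (doubleBroom n k).IsTree := by
  have hconn : (doubleBroom n k).Connected :=
    (SimpleGraph.induceUnivIso _).connected_iff.1
      (connected_induce_of_spine_subset hk (Set.subset_univ _))
  refine SimpleGraph.isTree_iff_connected_and_card.2 ⟨hconn, le_antisymm ?_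
    hconn.card_vert_le_card_edgeSet_add_one⟩
  classical
  -- Every edge joins a vertex other than the root `k` to its parent, so there are at most `n - 1`
  -- edges; connectedness gives the reverse inequality.
  have hsub : (doubleBroom n k).edgeSet ⊆
      ((univ.erase (⟨k, by omega⟩ : Fin n)).image fun x => s(x, parent n k hk x) :
        Finset (Sym2 (Fin n))) := by
    intro e
    induction e using Sym2.ind with
    | _ x y =>
      intro h
      rw [SimpleGraph.mem_edgeSet, doubleBroom_adj] at h
      have key : ∀ x y : Fin n, level n k x + 1 = level n k y →
          (x ≠ ⟨k, by omega⟩ ∧ parent n k hk x = y) ∨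
          (y ≠ ⟨k, by omega⟩ ∧ parent n k hk y = x) := by
        intro x y h
        rw [level, level] at h
        have := x.2
        have := y.2
        simp only [parent, Fin.ext_iff, ne_eq]
        split_ifs <;> simp only <;> omega
      have key2 : (x ≠ ⟨k, by omega⟩ ∧ parent n k hk x = y) ∨
          (y ≠ ⟨k, by omega⟩ ∧ parent n k hk y = x) := by
        rcases h with h | h
        · exact key x y h
        · exact (key y x h).symm
      rw [mem_coe, mem_image]
      rcases key2 with ⟨h1, h2⟩ | ⟨h1, h2⟩
      · exact ⟨x, mem_erase.2 ⟨h1, mem_univ _⟩, by rw [h2]⟩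
      · exact ⟨y, mem_erase.2 ⟨h1, mem_univ _⟩, by rw [h2, Sym2.eq_swap]⟩
  have h1 : Nat.card (doubleBroom n k).edgeSet ≤ (univ.erase (⟨k, by omega⟩ : Fin n)).card := by
    rw [Nat.card_coe_set_eq]
    refine (Set.ncard_le_ncard hsub (finite_toSet _)).trans ?_
    rw [Set.ncard_coe_finset]
    exact card_image_le
  rw [Nat.card_eq_fintype_card (α := Fin n), ← card_univ,
    ← card_erase_add_one (mem_univ (⟨k, by omega⟩ : Fin n))]
  omega

/-- A discrete intermediate value theorem: levels change by one along an edge. Since each spine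
level is attained only once, connected sets meet the spine in intervals. -/
theorem exists_level_eq {x y : Fin n} (p : (doubleBroom n k).Walk x y) {j : ℕ}
    (hx : level n k x ≤ j) (hy : j ≤ level n k y) : ∃ z ∈ p.support, level n k z = j := by
  induction p with
  | nil => exact ⟨_, SimpleGraph.Walk.start_mem_support _, le_antisymm hx hy⟩
  | @cons x w y h p ih =>
    rcases eq_or_lt_of_le hx with hx | hx
    · exact ⟨x, SimpleGraph.Walk.start_mem_support _, hx⟩
    · obtain ⟨z, hz, hzj⟩ := ih (by rw [doubleBroom_adj] at h; omega) hy
      exact ⟨z, by simp [hz], hzj⟩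

/-! ### Classification and counting of the subtrees of a double broom -/

variable {S : Finset (Fin n)}

theorem mem_of_connected (hS : ((doubleBroom n k).induce (S : Set (Fin n))).Connected)
    {x y z : Fin n} (hx : x ∈ S) (hy : y ∈ S) (hxz : x ≤ z) (hzy : z ≤ y) (hz : z ∈ spine n k) :
    z ∈ S := by
  obtain ⟨p, hp⟩ := exists_walk_of_induce (mem_coe.2 hx) (mem_coe.2 hy) (hS.preconnected _ _)
  rw [Fin.le_def] at hxz hzy
  obtain ⟨w, hw, hwz⟩ := exists_level_eq p (j := level n k z)
    (by simp only [level]; omega) (by simp only [level]; omega)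
  have : w = z := by
    rw [mem_spine] at hz
    simp only [level] at hwz
    ext
    omega
  exact this ▸ hp w hw

theorem exists_mem_spine_of_connected (hk : 2 * k < n)
    (hS : ((doubleBroom n k).induce (S : Set (Fin n))).Connected)
    {x y : Fin n} (hx : x ∈ S) (hy : y ∈ S) (hxy : x ≠ y) : ∃ z ∈ S, z ∈ spine n k := by
  obtain ⟨p, hp⟩ := exists_walk_of_induce (mem_coe.2 hx) (mem_coe.2 hy) (hS.preconnected _ _)
  cases p with
  | nil => exact absurd rfl hxy
  | @cons _ w _ h q =>
    have hw : w ∈ S := hp w (by simp)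
    by_cases hxs : x ∈ spine n k
    · exact ⟨x, hx, hxs⟩
    · refine ⟨w, hw, ?_⟩
      rw [mem_spine] at hxs ⊢
      rw [doubleBroom_adj, level, level] at h
      have := x.2
      have := w.2
      omega

/-- The leaves at the lower end. -/
def lowerLeaves (n k : ℕ) : Finset (Fin n) := univ.filter fun x => x.1 < k

/-- The leaves at the upper end. -/
def upperLeaves (n k : ℕ) : Finset (Fin n) := univ.filter fun x => n - k ≤ x.1

theorem card_fin_filter_interval {a b : ℕ} (hb : b ≤ n) :
    (univ.filter fun x : Fin n => a ≤ x.1 ∧ x.1 < b).card = b - a := by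
  rw [← Nat.card_Ico, ← card_map Fin.valEmbedding]
  congr 1
  ext x
  simp only [mem_map, mem_filter, mem_univ, true_and, Fin.valEmbedding_apply, mem_Ico]
  constructor
  · rintro ⟨y, hy, rfl⟩
    exact hy
  · intro h
    exact ⟨⟨x, by omega⟩, h, rfl⟩

theorem card_spine (n k : ℕ) : (spine n k).card = n - k - k :=
  card_fin_filter_interval (by omega)

theorem card_lowerLeaves (hk : 2 * k < n) : (lowerLeaves n k).card = k := by
  have h := card_fin_filter_interval (n := n) (a := 0) (b := k) (by omega)
  simpa [lowerLeaves] using h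

theorem card_upperLeaves (hk : 2 * k < n) : (upperLeaves n k).card = k := by
  have h := card_fin_filter_interval (n := n) (a := n - k) (b := n) le_rfl
  simp only [Fin.is_lt, and_true] at h
  rw [upperLeaves, h]
  omega

theorem sum_powerset_card_sub {α : Type*} (X : Finset α) :
    ∑ L ∈ X.powerset, ((X.card : ℝ) - L.card) = X.card * 2 ^ X.card / 2 := by
  classical
  induction X using Finset.induction with
  | empty => simp
  | insert a X ha ih =>
    rw [sum_powerset_insert ha]
    have h1 : ∀ L ∈ X.powerset, (((insert a X).card : ℝ) - (insert a L).card) =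
        (X.card : ℝ) - L.card := by
      intro L hL
      rw [card_insert_of_notMem ha, card_insert_of_notMem (fun h => ha (mem_powerset.1 hL h))]
      push_cast
      ring
    have h2 : ∀ L ∈ X.powerset, (((insert a X).card : ℝ) - L.card) =
        ((X.card : ℝ) - L.card) + 1 := by
      intro L _
      rw [card_insert_of_notMem ha]
      push_cast
      ring
    rw [sum_congr rfl h1, sum_congr rfl h2, sum_add_distrib, ih, sum_const, card_powerset,
      card_insert_of_notMem ha, pow_succ]
    push_cast
    simp only [nsmul_eq_mul]
    push_cast
    ring

theorem sum_union_le_of_nonneg {α : Type*} [DecidableEq α] (A B : Finset α) {w : α → ℝ}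
    (hw : ∀ x, 0 ≤ w x) : ∑ x ∈ A ∪ B, w x ≤ ∑ x ∈ A, w x + ∑ x ∈ B, w x := by
  rw [← sum_union_inter]
  exact le_add_of_nonneg_right (sum_nonneg fun x _ => hw x)

theorem sum_image_le_sum {α β : Type*} [DecidableEq β] (A : Finset α) (g : α → β) {w : β → ℝ}
    (hw : ∀ x, 0 ≤ w x) : ∑ x ∈ A.image g, w x ≤ ∑ a ∈ A, w (g a) :=
  sum_image_le_of_nonneg fun x _ => hw x

/-- The subtrees that contain the whole path. -/
def fullFamily (n k : ℕ) : Finset (Finset (Fin n)) :=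
  (lowerLeaves n k ∪ upperLeaves n k).powerset.image fun L => spine n k ∪ L

/-- Subsets with an initial segment of the path and leaves at the lower end. -/
def lowerEndFamily (n k : ℕ) : Finset (Finset (Fin n)) :=
  (range (n - 2 * k) ×ˢ (lowerLeaves n k).powerset).image fun p =>
    (univ.filter fun x : Fin n => k ≤ x.1 ∧ x.1 < k + p.1) ∪ p.2

/-- Subsets with a final segment of the path and leaves at the upper end. -/
def upperEndFamily (n k : ℕ) : Finset (Finset (Fin n)) :=
  (range (n - 2 * k) ×ˢ (upperLeaves n k).powerset).image fun p =>
    (univ.filter fun x : Fin n => n - k - p.1 ≤ x.1 ∧ x.1 < n - k) ∪ p.2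

/-- Intervals of vertices. -/
def intervalFamily (n : ℕ) : Finset (Finset (Fin n)) :=
  (univ ×ˢ univ).image fun p : Fin n × Fin n => Icc p.1 p.2

/-- A subtree containing a leaf and a spine vertex contains the spine end next to that leaf. The
four families correspond to which spine ends are reached; an inclusion suffices, since only an upper
bound on the missing total is needed. -/
theorem subtrees_doubleBroom_subset (hk : 2 * k < n) :
    subtreesContaining (doubleBroom n k) ∅ ⊆
      (fullFamily n k ∪ lowerEndFamily n k) ∪ (upperEndFamily n k ∪ intervalFamily n) := by
  intro S hS
  have hS := (mem_subtreesContaining.1 hS).2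
  obtain ⟨⟨x₀, hx₀⟩⟩ := hS.nonempty
  have hx₀ : x₀ ∈ S := hx₀
  simp only [mem_union]
  by_cases hne : (S ∩ spine n k).Nonempty
  swap
  -- A subtree without spine vertices is a single leaf, that is, a one-point interval.
  · refine Or.inr (Or.inr (mem_image.2 ⟨(x₀, x₀), by simp, ?_⟩))
    rw [Icc_self, eq_comm, eq_singleton_iff_unique_mem]
    refine ⟨hx₀, fun y hy => ?_⟩
    by_contra hxy
    obtain ⟨z, hz, hz'⟩ := exists_mem_spine_of_connected hk hS hy hx₀ hxy
    exact hne ⟨z, mem_inter.2 ⟨hz, hz'⟩⟩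
  set a := (S ∩ spine n k).min' hne with ha
  set b := (S ∩ spine n k).max' hne with hb
  have haS := mem_inter.1 ((S ∩ spine n k).min'_mem hne)
  have hbS := mem_inter.1 ((S ∩ spine n k).max'_mem hne)
  rw [← ha, mem_spine] at haS
  rw [← hb, mem_spine] at hbS
  have hle : ∀ x ∈ S, k ≤ x.1 → x.1 < n - k → a.1 ≤ x.1 ∧ x.1 ≤ b.1 := fun x hx h1 h2 =>
    have hm := mem_inter.2 ⟨hx, mem_spine.2 ⟨h1, h2⟩⟩
    ⟨min'_le _ _ hm, le_max' _ _ hm⟩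
  have hmid : ∀ x : Fin n, a.1 ≤ x.1 → x.1 ≤ b.1 → x ∈ S := fun x h1 h2 =>
    mem_of_connected hS haS.1 hbS.1 h1 h2 (mem_spine.2 ⟨by omega, by omega⟩)
  have hlow : ∀ x ∈ S, x.1 < k → a.1 = k := by
    intro x hx hxk
    have h1 : (⟨k, by omega⟩ : Fin n) ∈ S :=
      mem_of_connected hS hx haS.1 (Fin.le_def.2 hxk.le) (Fin.le_def.2 haS.2.1)
        (mem_spine.2 ⟨le_rfl, by simp only; omega⟩)
    have := hle _ h1 le_rfl (by simp only; omega)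
    simp only at this
    omega
  have hupp : ∀ x ∈ S, n - k ≤ x.1 → b.1 = n - k - 1 := by
    intro x hx hxk
    have h1 : (⟨n - k - 1, by omega⟩ : Fin n) ∈ S :=
      mem_of_connected hS hbS.1 hx (Fin.le_def.2 (by simp only; omega))
        (Fin.le_def.2 (by simp only; omega)) (mem_spine.2 ⟨by simp only; omega, by simp only; omega⟩)
    have := hle _ h1 (by simp only; omega) (by simp only; omega)
    simp only at this
    omega
  by_cases hak : a.1 = k
  · by_cases hbk : b.1 = n - k - 1
    · refine Or.inl (Or.inl (mem_image.2 ⟨S \ spine n k, ?_, ?_⟩))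
      · rw [mem_powerset]
        intro x hx
        rw [mem_sdiff, mem_spine] at hx
        simp only [mem_union, lowerLeaves, upperLeaves, mem_filter, mem_univ, true_and]
        omega
      · refine union_sdiff_of_subset fun x hx => ?_
        rw [mem_spine] at hx
        exact hmid x (by omega) (by omega)
    · refine Or.inl (Or.inr (mem_image.2 ⟨(b.1 + 1 - k, S.filter fun x => x.1 < k), ?_, ?_⟩))
      · simp only [mem_product, mem_range, mem_powerset]
        refine ⟨by omega, fun x hx => ?_⟩
        simp only [lowerLeaves, mem_filter, mem_univ, true_and] at hx ⊢
        exact hx.2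
      · ext x
        simp only [mem_union, mem_filter, mem_univ, true_and]
        constructor
        · rintro (⟨h1, h2⟩ | h)
          · exact hmid x (by omega) (by omega)
          · exact h.1
        · intro hx
          by_cases h1 : x.1 < k
          · exact Or.inr ⟨hx, h1⟩
          · have h2 : x.1 < n - k := by
              by_contra h
              exact hbk (hupp x hx (by omega))
            have := hle x hx (by omega) h2
            exact Or.inl ⟨by omega, by omega⟩
  · have hnl : ∀ x ∈ S, k ≤ x.1 := by
      intro x hx
      by_contra h
      exact hak (hlow x hx (by omega))
    by_cases hbk : b.1 = n - k - 1
    · refine Or.inr (Or.inl (mem_image.2 ⟨(n - k - a.1, S.filter fun x => n - k ≤ x.1), ?_, ?_⟩))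
      · simp only [mem_product, mem_range, mem_powerset]
        refine ⟨by omega, fun x hx => ?_⟩
        simp only [upperLeaves, mem_filter, mem_univ, true_and] at hx ⊢
        exact hx.2
      · ext x
        simp only [mem_union, mem_filter, mem_univ, true_and]
        constructor
        · rintro (⟨h1, h2⟩ | h)
          · exact hmid x (by omega) (by omega)
          · exact h.1
        · intro hx
          by_cases h1 : n - k ≤ x.1
          · exact Or.inr ⟨hx, h1⟩
          · have := hle x hx (hnl x hx) (by omega)
            exact Or.inl ⟨by omega, by omega⟩
    · refine Or.inr (Or.inr (mem_image.2 ⟨(a, b), by simp, ?_⟩))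
      ext x
      rw [mem_Icc, Fin.le_def, Fin.le_def]
      constructor
      · exact fun h => hmid x h.1 h.2
      · intro hx
        refine hle x hx (hnl x hx) ?_
        by_contra h
        exact hbk (hupp x hx (by omega))

theorem disjoint_spine_leaves {L : Finset (Fin n)} (hL : L ⊆ lowerLeaves n k ∪ upperLeaves n k) :
    Disjoint (spine n k) L := by
  rw [Finset.disjoint_left]
  intro x hx hxL
  have := hL hxL
  simp only [mem_union, lowerLeaves, upperLeaves, mem_filter, mem_univ, true_and] at this
  rw [mem_spine] at hx
  omega

theorem card_leaves (hk : 2 * k < n) : (lowerLeaves n k ∪ upperLeaves n k).card = 2 * k := by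
  rw [card_union_of_disjoint, card_lowerLeaves hk, card_upperLeaves hk, two_mul]
  rw [Finset.disjoint_left]
  intro x hx hx'
  simp only [lowerLeaves, upperLeaves, mem_filter, mem_univ, true_and] at hx hx'
  omega

theorem four_pow_le_card_subtrees (hk : 2 * k < n) :
    4 ^ k ≤ (subtreesContaining (doubleBroom n k) ∅).card := by
  have h1 : (fullFamily n k).card = 4 ^ k := by
    rw [fullFamily, card_image_of_injOn, card_powerset, card_leaves hk, pow_mul]
    · norm_num
    intro L hL L' hL' h
    simp only at h
    have d := disjoint_spine_leaves (mem_powerset.1 (mem_coe.1 hL))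
    have d' := disjoint_spine_leaves (mem_powerset.1 (mem_coe.1 hL'))
    rw [← union_sdiff_cancel_left d, h, union_sdiff_cancel_left d']
  rw [← h1]
  refine card_le_card fun S hS => mem_subtreesContaining.2 ⟨empty_subset _, ?_⟩
  obtain ⟨L, -, rfl⟩ := mem_image.1 hS
  exact connected_induce_of_spine_subset hk (by simp)

/-- Only leaves can be missed, and on average half of the `2 * k` leaves are. -/
theorem sum_fullFamily_le (hk : 2 * k < n) :
    ∑ S ∈ fullFamily n k, ((n : ℝ) - S.card) ≤ k * 4 ^ k := by
  have hw : ∀ S : Finset (Fin n), 0 ≤ (n : ℝ) - S.card := fun S => by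
    have : S.card ≤ n := by simpa using card_le_univ S
    exact sub_nonneg.2 (by exact_mod_cast this)
  refine (sum_image_le_sum _ _ hw).trans (le_of_eq ?_)
  have : ∀ L ∈ (lowerLeaves n k ∪ upperLeaves n k).powerset,
      ((n : ℝ) - (spine n k ∪ L).card) =
        ((lowerLeaves n k ∪ upperLeaves n k).card : ℝ) - L.card := by
    intro L hL
    rw [card_union_of_disjoint (disjoint_spine_leaves (mem_powerset.1 hL)), card_spine,
      card_leaves hk, Nat.sub_sub, Nat.cast_add, Nat.cast_sub (by omega)]
    push_cast
    ring
  rw [sum_congr rfl this, sum_powerset_card_sub, card_leaves hk, pow_mul]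
  push_cast
  norm_num
  ring

theorem sum_range_sub_le (hk : 2 * k < n) :
    ∑ t ∈ range (n - 2 * k), ((n : ℝ) - t) ≤ ((n : ℝ) ^ 2 + n) / 2 := by
  have h : ∀ l : ℕ, ∑ t ∈ range l, ((n : ℝ) - t) = l * n - l * (l - 1) / 2 := by
    intro l
    induction l with
    | zero => simp
    | succ l ih =>
      rw [sum_range_succ, ih]
      push_cast
      ring
  rw [h, Nat.cast_sub (by omega)]
  push_cast
  have : (0 : ℝ) ≤ k := Nat.cast_nonneg _
  nlinarith

theorem sum_segments_le (hk : 2 * k < n) {X : Finset (Fin n)} (hX : X.card = k)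
    {seg : ℕ → Finset (Fin n)} (hseg : ∀ t, t < n - 2 * k → (seg t).card = t) :
    ∑ S ∈ (range (n - 2 * k) ×ˢ X.powerset).image (fun p => seg p.1 ∪ p.2),
      ((n : ℝ) - S.card) ≤ 2 ^ k * (((n : ℝ) ^ 2 + n) / 2) := by
  have hw : ∀ S : Finset (Fin n), 0 ≤ (n : ℝ) - S.card := fun S => by
    have : S.card ≤ n := by simpa using card_le_univ S
    exact sub_nonneg.2 (by exact_mod_cast this)
  refine (sum_image_le_sum _ _ hw).trans ?_
  rw [sum_product_right]
  have h1 : ∀ L ∈ X.powerset, ∑ t ∈ range (n - 2 * k), ((n : ℝ) - (seg t ∪ L).card) ≤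
      ((n : ℝ) ^ 2 + n) / 2 := by
    intro L _
    refine (sum_le_sum fun t ht => ?_).trans (sum_range_sub_le hk)
    have : t ≤ (seg t ∪ L).card :=
      (hseg t (mem_range.1 ht)).symm.le.trans (card_le_card subset_union_left)
    have : (t : ℝ) ≤ (seg t ∪ L).card := by exact_mod_cast this
    linarith
  refine (sum_le_card_nsmul _ _ _ h1).trans (le_of_eq ?_)
  rw [card_powerset, hX, nsmul_eq_mul]
  push_cast
  ring

theorem sum_intervalFamily_le (n : ℕ) :
    ∑ S ∈ intervalFamily n, ((n : ℝ) - S.card) ≤ (n : ℝ) ^ 3 := by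
  have h1 : (intervalFamily n).card ≤ n * n := by
    refine card_image_le.trans (le_of_eq ?_)
    simp
  have h2 := sum_le_card_nsmul (intervalFamily n) (fun S => (n : ℝ) - S.card) n
    (fun S _ => by simp)
  rw [nsmul_eq_mul] at h2
  have h3 : ((intervalFamily n).card : ℝ) ≤ n * n := by exact_mod_cast h1
  have h4 := mul_le_mul_of_nonneg_right h3 (Nat.cast_nonneg n : (0 : ℝ) ≤ n)
  calc _ ≤ _ := h2
    _ ≤ _ := h4
    _ = _ := by ring

/-- The missing totals of the four families are divided by `4 ^ k`, a lower bound for the number of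
subtrees: full subtrees contribute `k`, the two one-ended families `(n² + n) / 2 ^ k`, and intervals
`n³ / 4 ^ k`. -/
theorem le_meanSubtreeOrder_doubleBroom (hk : 2 * k < n) :
    (n : ℝ) - (k + ((n : ℝ) ^ 2 + n) / 2 ^ k + (n : ℝ) ^ 3 / 4 ^ k) ≤
      meanSubtreeOrder (doubleBroom n k) := by
  have hw : ∀ S : Finset (Fin n), 0 ≤ (n : ℝ) - S.card := fun S => by
    have : S.card ≤ n := by simpa using card_le_univ S
    exact sub_nonneg.2 (by exact_mod_cast this)
  set F := subtreesContaining (doubleBroom n k) ∅ with hF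
  have hcard : (4 : ℝ) ^ k ≤ F.card := by exact_mod_cast four_pow_le_card_subtrees hk
  have h4 : (0 : ℝ) < 4 ^ k := by positivity
  have htotal : ∑ S ∈ F, ((n : ℝ) - S.card) ≤
      k * 4 ^ k + 2 ^ k * ((n : ℝ) ^ 2 + n) + (n : ℝ) ^ 3 := by
    refine (sum_le_sum_of_subset_of_nonneg (subtrees_doubleBroom_subset hk)
      fun S _ _ => hw S).trans ?_
    refine (sum_union_le_of_nonneg _ _ hw).trans ?_
    have a1 := sum_union_le_of_nonneg (fullFamily n k) (lowerEndFamily n k) hw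
    have a2 := sum_union_le_of_nonneg (upperEndFamily n k) (intervalFamily n) hw
    have a3 : ∑ S ∈ lowerEndFamily n k, ((n : ℝ) - S.card) ≤ 2 ^ k * (((n : ℝ) ^ 2 + n) / 2) :=
      sum_segments_le (seg := fun t => univ.filter fun x : Fin n => k ≤ x.1 ∧ x.1 < k + t) hk
        (card_lowerLeaves hk) fun t ht => by
        rw [card_fin_filter_interval (by omega)]
        omega
    have a4 : ∑ S ∈ upperEndFamily n k, ((n : ℝ) - S.card) ≤ 2 ^ k * (((n : ℝ) ^ 2 + n) / 2) :=
      sum_segments_le (seg := fun t => univ.filter fun x : Fin n => n - k - t ≤ x.1 ∧ x.1 < n - k)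
        hk (card_upperLeaves hk) fun t ht => by
        rw [card_fin_filter_interval (by omega)]
        omega
    linarith [sum_fullFamily_le hk, sum_intervalFamily_le n]
  have hN : (0 : ℝ) < F.card := h4.trans_le hcard
  have e : meanSubtreeOrder (doubleBroom n k) =
      n - (∑ S ∈ F, ((n : ℝ) - S.card)) / F.card := by
    rw [meanSubtreeOrder, meanOrderContaining, ← hF, sum_sub_distrib, sum_const, nsmul_eq_mul]
    field_simp
    ring
  have h5 : (∑ S ∈ F, ((n : ℝ) - S.card)) / F.card ≤
      (k * 4 ^ k + 2 ^ k * ((n : ℝ) ^ 2 + n) + (n : ℝ) ^ 3) / 4 ^ k :=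
    div_le_div₀ (by positivity) htotal h4 hcard
  have e2 : (k * 4 ^ k + 2 ^ k * ((n : ℝ) ^ 2 + n) + (n : ℝ) ^ 3) / 4 ^ k =
      k + ((n : ℝ) ^ 2 + n) / 2 ^ k + (n : ℝ) ^ 3 / 4 ^ k := by
    have : (4 : ℝ) ^ k = 2 ^ k * 2 ^ k := by rw [← mul_pow]; norm_num
    rw [this]
    field_simp
  rw [e, ← e2]
  linarith

end DoubleBroom

end SubtreeOrder

namespace SubtreeOrder

universe u

open Filter Topology

/-! ### The maximum of the mean subtree order -/

theorem exists_tendsto_zero_of_eventually {P : ℕ → ℝ → Prop}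
    (mono : ∀ n a b, a ≤ b → P n a → P n b) (ex : ∀ n, ∃ a, P n a)
    (ev : ∀ η > 0, ∀ᶠ n in atTop, P n η) :
    ∃ ε : ℕ → ℝ, Tendsto ε atTop (𝓝 0) ∧ ∀ n, P n (ε n) := by
  have bdd : ∀ n, BddBelow {a | 0 < a ∧ P n a} := fun n => ⟨0, fun a ha => ha.1.le⟩
  have ne : ∀ n, {a | 0 < a ∧ P n a}.Nonempty := fun n => by
    obtain ⟨a, ha⟩ := ex n
    exact ⟨max a 1, lt_max_of_lt_right one_pos, mono n _ _ (le_max_left _ _) ha⟩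
  -- The infimum of the admissible errors need not be admissible; adding `1 / (n + 1)` ensures this
  -- without affecting the limit.
  refine ⟨fun n => sInf {a | 0 < a ∧ P n a} + 1 / ((n : ℝ) + 1), ?_, fun n => ?_⟩
  · have h : Tendsto (fun n => sInf {a | 0 < a ∧ P n a}) atTop (𝓝 0) := by
      refine tendsto_order.2 ⟨fun a ha => ?_, fun a ha => ?_⟩
      · exact Eventually.of_forall fun n => ha.trans_le (le_csInf (ne n) fun b hb => hb.1.le)
      · filter_upwards [ev (a / 2) (by linarith)] with n hn
        have := csInf_le (bdd n) ⟨by linarith, hn⟩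
        linarith
    simpa using h.add tendsto_one_div_add_atTop_nhds_zero_nat
  · have hpos : 0 < 1 / ((n : ℝ) + 1) := by positivity
    obtain ⟨a, ha, hlt⟩ := exists_lt_of_csInf_lt (ne n) (lt_add_of_pos_right _ hpos)
    exact mono n _ _ hlt.le ha.2

theorem exists_isGreatest_meanSubtreeOrders {n : ℕ} (hn : 1 ≤ n) :
    ∃ M, IsGreatest (meanSubtreeOrders n) M := by
  have hfin : (meanSubtreeOrders n).Finite :=
    (Set.finite_range fun T : SimpleGraph (Fin n) => meanSubtreeOrder T).subset
      fun x ⟨T, _, hx⟩ => ⟨T, hx⟩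
  have hne : (meanSubtreeOrders n).Nonempty :=
    ⟨_, doubleBroom n 0, doubleBroom_isTree (by omega), rfl⟩
  obtain ⟨M, hM, hmax⟩ := hfin.exists_maximal hne
  exact ⟨M, hM, fun x hx => (le_total x M).elim id fun h => hmax hx h⟩

theorem eventually_exists_isTree_le_meanSubtreeOrder {η : ℝ} (hη : 0 < η) :
    ∀ᶠ n : ℕ in atTop, ∃ T : SimpleGraph (Fin n), T.IsTree ∧
      (n : ℝ) - 2 * Real.logb 2 n + f (2 * Real.logb 2 n) - η ≤ meanSubtreeOrder T := by
  have ev : ∀ᶠ x : ℝ in atTop, 1 ≤ x ∧ 6 / η ≤ x ∧ Real.logb 2 x / x < 1 / 4 :=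
    (eventually_ge_atTop 1).and ((eventually_ge_atTop _).and
      (tendsto_logb_div_atTop.eventually_lt_const (by norm_num)))
  filter_upwards [tendsto_natCast_atTop_atTop.eventually ev] with n hn
  obtain ⟨h1, h6, hlog⟩ := hn
  have hn0 : (0 : ℝ) < n := by linarith
  -- The number of leaves at each end is `k = ⌊2 log₂ n⌋`, so `n² = 2 ^ k * s` and the main term `k
  -- + s` equals `2 * minLine (n²)`.
  obtain ⟨s, s1, s2, hs, hm⟩ := exists_minLine_eq (y := (n : ℝ) ^ 2) (by positivity)
  rw [minLine] at hm
  have hL : Real.logb 2 ((n : ℝ) ^ 2) = 2 * Real.logb 2 n := by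
    rw [Real.logb_pow]
    push_cast
    rfl
  rw [hL] at hs hm
  have hfloor : 0 ≤ ⌊2 * Real.logb 2 (n : ℝ)⌋ :=
    Int.floor_nonneg.2 (by linarith [Real.logb_nonneg (by norm_num : (1 : ℝ) < 2) h1])
  obtain ⟨k, hk⟩ := Int.eq_ofNat_of_zero_le hfloor
  have hkle : (k : ℝ) ≤ 2 * Real.logb 2 n := by
    have := Int.floor_le (2 * Real.logb 2 (n : ℝ))
    rw [hk] at this
    exact_mod_cast this
  rw [hk] at hs hm
  rw [zpow_natCast] at hs
  push_cast at hm
  have hkn : 2 * k < n := by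
    rw [div_lt_iff₀ hn0] at hlog
    have : (2 : ℝ) * k < n := by linarith
    exact_mod_cast this
  refine ⟨doubleBroom n k, doubleBroom_isTree hkn,
    le_trans ?_ (le_meanSubtreeOrder_doubleBroom hkn)⟩
  have hq : (0 : ℝ) < 2 ^ k := by positivity
  have e1 : ((n : ℝ) ^ 2 + n) / 2 ^ k = s + s / n := by
    have hsq : s = (n : ℝ) ^ 2 / 2 ^ k := by rw [hs]; field_simp
    rw [hsq]
    field_simp
  have e2 : (n : ℝ) ^ 3 / 4 ^ k = s ^ 2 / n := by
    have h4 : (4 : ℝ) ^ k = 2 ^ k * 2 ^ k := by rw [← mul_pow]; norm_num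
    have hsq : s = (n : ℝ) ^ 2 / 2 ^ k := by rw [hs]; field_simp
    rw [hsq, h4]
    field_simp
  -- Since `s ≤ 2`, the numerator `s + s²` is at most 6, hence the condition `6 / η ≤ n`.
  have b1 : s / n + s ^ 2 / n ≤ η := by
    rw [← add_div, div_le_iff₀ hn0]
    rw [div_le_iff₀ hη] at h6
    nlinarith
  rw [e1, e2]
  linarith

theorem eventually_meanSubtreeOrder_le {η : ℝ} (hη : 0 < η) :
    ∀ᶠ n : ℕ in atTop, ∀ (V : Type u) [Fintype V] (T : SimpleGraph V),
      Fintype.card V = n → T.IsTree → meanSubtreeOrder T ≤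
        (n : ℝ) - 2 * Real.logb 2 n + 2 + f (2 * Real.logb 2 n) + η := by
  have ev : ∀ᶠ x : ℝ in atTop, 0 < x ∧ Real.logb 2 x / x < 1 / 4 :=
    (eventually_gt_atTop 0).and (tendsto_logb_div_atTop.eventually_lt_const (by norm_num))
  filter_upwards [eventually_localMeanSubtreeOrder_le.{u} hη,
    tendsto_natCast_atTop_atTop.eventually ev] with n hn hlog V _ T hcard hT
  obtain ⟨v, hv⟩ := exists_isCentroid hT
  refine meanSubtreeOrder_le_of_isCentroid hv (hn V T v hcard hT hv) ?_
  -- Together with `log₂ n < n / 4`, this keeps the bound above `n / 2`, as the comparison of global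
  -- and local means requires.
  have hf : -2 ≤ f (2 * Real.logb 2 n) := by
    have h1 : (2 : ℝ) ^ Int.fract (2 * Real.logb 2 (n : ℝ)) ≤ 2 ^ (1 : ℝ) :=
      Real.rpow_le_rpow_of_exponent_le (by norm_num) (Int.fract_lt_one _).le
    rw [Real.rpow_one] at h1
    rw [f]
    linarith [Int.fract_nonneg (2 * Real.logb 2 (n : ℝ))]
  have h2 := hlog.2
  rw [div_lt_iff₀ hlog.1] at h2
  rw [hcard]
  linarith

end SubtreeOrder

/-! ### Assembly of the error sequences -/

open SubtreeOrder Filter Topology in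
theorem mainTheorem4 :
    (∃ ε : ℕ → ℝ, Tendsto ε atTop (𝓝 0) ∧
      ∀ (V : Type*) [Fintype V] (T : SimpleGraph V) (v : V), T.IsTree → IsCentroid T v →
        localMeanSubtreeOrder T v ≤
          (Fintype.card V : ℝ) - 2 * Real.logb 2 (Fintype.card V) + 2
            + f (2 * Real.logb 2 (Fintype.card V)) + ε (Fintype.card V)) ∧
    (∃ ε₁ ε₂ : ℕ → ℝ, Tendsto ε₁ atTop (𝓝 0) ∧ Tendsto ε₂ atTop (𝓝 0) ∧
      ∀ n : ℕ, 1 ≤ n → ∃ M : ℝ, IsGreatest (meanSubtreeOrders n) M ∧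
        (n : ℝ) - 2 * Real.logb 2 n + f (2 * Real.logb 2 n) + ε₁ n ≤ M ∧
        M ≤ (n : ℝ) - 2 * Real.logb 2 n + 2 + f (2 * Real.logb 2 n) + ε₂ n) := by
  constructor
  · obtain ⟨ε, hε, h⟩ := exists_tendsto_zero_of_eventually
      (P := fun n a => ∀ (V : Type _) [Fintype V] (T : SimpleGraph V) (v : V),
        Fintype.card V = n → T.IsTree → IsCentroid T v → localMeanSubtreeOrder T v ≤
          (n : ℝ) - 2 * Real.logb 2 n + 2 + f (2 * Real.logb 2 n) + a)
      (fun n a b hab h V _ T v hc hT hv => (h V T v hc hT hv).trans (by linarith))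
      -- For each fixed `n` some error works uniformly over all trees, because a mean order is at
      -- most `n`.
      (fun n => ⟨2 * Real.logb 2 n - 2 - f (2 * Real.logb 2 n), fun V _ T v hc _ _ => by
        have := meanOrderContaining_le_card T {v}
        rw [hc] at this
        rw [localMeanSubtreeOrder]
        linarith⟩)
      (fun η hη => eventually_localMeanSubtreeOrder_le hη)
    exact ⟨ε, hε, fun V _ T v hT hv => h _ V T v rfl hT hv⟩
  · choose! M hM using fun n (hn : 1 ≤ n) => exists_isGreatest_meanSubtreeOrders hn
    obtain ⟨ε₁, hε₁, h₁⟩ := exists_tendsto_zero_of_eventually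
      (P := fun n a => 1 ≤ n →
        (n : ℝ) - 2 * Real.logb 2 n + f (2 * Real.logb 2 n) - a ≤ M n)
      (fun n a b hab h hn => le_trans (by linarith) (h hn))
      (fun n => ⟨(n : ℝ) - 2 * Real.logb 2 n + f (2 * Real.logb 2 n) - M n, fun _ => by linarith⟩)
      (fun η hη => by
        filter_upwards [eventually_exists_isTree_le_meanSubtreeOrder hη] with n hn h1
        obtain ⟨T, hT, hle⟩ := hn
        exact hle.trans ((hM n h1).2 ⟨T, hT, rfl⟩))
    obtain ⟨ε₂, hε₂, h₂⟩ := exists_tendsto_zero_of_eventually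
      (P := fun n a => 1 ≤ n →
        M n ≤ (n : ℝ) - 2 * Real.logb 2 n + 2 + f (2 * Real.logb 2 n) + a)
      (fun n a b hab h hn => (h hn).trans (by linarith))
      (fun n => ⟨M n - ((n : ℝ) - 2 * Real.logb 2 n + 2 + f (2 * Real.logb 2 n)),
        fun _ => by linarith⟩)
      (fun η hη => by
        filter_upwards [eventually_meanSubtreeOrder_le hη] with n hn h1
        obtain ⟨T, hT, hTM⟩ := (hM n h1).1
        rw [← hTM]
        exact hn (Fin n) T (Fintype.card_fin n) hT)
    refine ⟨fun n => -ε₁ n, ε₂, by simpa using hε₁.neg, hε₂, fun n hn => ⟨M n, hM n hn, ?_, h₂ n hn⟩⟩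
    have := h₁ n hn
    linarith
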